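/- Let $(M^n,g)$ be a connected, complete, noncompact smooth Riemannian manifold without boundary, $n\ge 3$, let $1\le k\le n$, and let $\sigma_k$ be the $\sigma_k$-curvature of $g$, that is, the $k$-th elementary symmetric function of the eigenvalues of $g^{-1}A_g$, where $A_g=\frac{1}{n-2}\left(\mathrm{Ric}_g-\frac{R_g}{2(n-1)}g\right)$ is the Schouten tensor. Suppose that $(M^n,g,f,\lambda)$ is a quasi $k$-Yamabe gradient soliton: $f:M\to\mathbb{R}$ is smooth, $m\neq 0$ and $\lambda$ are real constants, and $$\nabla^2 f-\frac1m\,df\otimes df=(\sigma_k-\lambda)\,g .$$ Let $d$ be the Riemannian distance, $dv_g$ the Riemannian volume measure and $d\mu=e^{-f/m}\,dv_g$. Suppose that for some point $x_0\in M$ and some $r>0$, with $B(r)$ the open ball of radius $r$ centered at $x_0$, $$\int_{M\setminus B(r)} d(x,x_0)^{-1}\,|\nabla f|\,d\mu<\infty ,$$ and that $f$ is $f$-subharmonic, meaning $\Delta f-\frac1m|\nabla f|^2\ge 0$ on $M$. Then $\sigma_k=\lambda$ at every point of $M$; in particular $(M^n,g)$ has constant $\sigma_k$-curvature. -/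

import Mathlib

open scoped Manifold ContDiff Bundle ENNReal

noncomputable section

namespace QuasiYamabe

open MeasureTheory Bundle

variable {n : ℕ} {M : Type*} [TopologicalSpace M] [ChartedSpace (EuclideanSpace ℝ (Fin n)) M]

/-- The partial derivative `∂ᵢ u` of a function `u` on an open subset of `ℝⁿ`. -/
def partialDeriv (i : Fin n) (u : EuclideanSpace ℝ (Fin n) → ℝ)
    (y : EuclideanSpace ℝ (Fin n)) : ℝ :=
  fderiv ℝ u y (EuclideanSpace.single i 1)

/-- The local representative `f ∘ φ⁻¹` of `f` in the chart `φ` around `c`. -/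
def inChart (c : M) (f : M → ℝ) (y : EuclideanSpace ℝ (Fin n)) : ℝ :=
  f ((extChartAt (𝓡 n) c).symm y)

/-- The coordinate vector field `∂ᵢ` of the chart `φ` around `c`, at the point `φ⁻¹ y`. -/
def coordField (c : M) (y : EuclideanSpace ℝ (Fin n)) (i : Fin n) :
    TangentSpace (𝓡 n) ((extChartAt (𝓡 n) c).symm y) :=
  mfderiv (𝓡 n) (𝓡 n) (extChartAt (𝓡 n) c).symm y
    (EuclideanSpace.single i (1 : ℝ) : EuclideanSpace ℝ (Fin n))

section Chart

variable [RiemannianBundle (fun x : M ↦ TangentSpace (𝓡 n) x)]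

/-- The components `gᵢⱼ = g(∂ᵢ, ∂ⱼ)` of the metric in the chart around `c`. -/
def metricMatrix (c : M) (y : EuclideanSpace ℝ (Fin n)) : Matrix (Fin n) (Fin n) ℝ :=
  Matrix.of fun i j ↦ inner ℝ (coordField c y i) (coordField c y j)

/-- The Christoffel symbols `Γˡᵢⱼ` of the Levi-Civita connection in the chart around `c`. -/
def christoffel (c : M) (l i j : Fin n) (y : EuclideanSpace ℝ (Fin n)) : ℝ :=
  (1 / 2) * ∑ s, (metricMatrix c y)⁻¹ l s *
    (partialDeriv i (fun z ↦ metricMatrix c z j s) y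
      + partialDeriv j (fun z ↦ metricMatrix c z i s) y
      - partialDeriv s (fun z ↦ metricMatrix c z i j) y)

/-- The components of the Ricci tensor in the chart around `c`:
`Ricᵢⱼ = ∂ₗ Γˡᵢⱼ - ∂ⱼ Γˡᵢₗ + Γˡₗₛ Γˢᵢⱼ - Γˡⱼₛ Γˢᵢₗ`. -/
def ricciMatrix (c : M) (y : EuclideanSpace ℝ (Fin n)) : Matrix (Fin n) (Fin n) ℝ :=
  Matrix.of fun i j ↦ ∑ l, (partialDeriv l (christoffel c l i j) y
      - partialDeriv j (christoffel c l i l) y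
      + ∑ s, (christoffel c l l s y * christoffel c s i j y
        - christoffel c l j s y * christoffel c s i l y))

/-- The components of the Hessian `∇²f` in the chart around `c`:
`∇²ᵢⱼ f = ∂ᵢ ∂ⱼ f - Γˡᵢⱼ ∂ₗ f`. -/
def hessianMatrix (f : M → ℝ) (c : M) (y : EuclideanSpace ℝ (Fin n)) :
    Matrix (Fin n) (Fin n) ℝ :=
  Matrix.of fun i j ↦ partialDeriv i (partialDeriv j (inChart c f)) y
    - ∑ l, christoffel c l i j y * partialDeriv l (inChart c f) y

/-- The components of `df ⊗ df` in the chart around `c`. -/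
def dfMatrix (f : M → ℝ) (c : M) (y : EuclideanSpace ℝ (Fin n)) : Matrix (Fin n) (Fin n) ℝ :=
  Matrix.of fun i j ↦ partialDeriv i (inChart c f) y * partialDeriv j (inChart c f) y

end Chart

section Pointwise

/-! Geometric quantities at a point `x`. The components of tensors are taken in the coordinate
basis of the distinguished chart around `x`, at `x`. -/

variable (n)

variable [RiemannianBundle (fun x : M ↦ TangentSpace (𝓡 n) x)]

/-- The metric at `x`. -/
def metricAt (x : M) : Matrix (Fin n) (Fin n) ℝ := metricMatrix x (extChartAt (𝓡 n) x x)

/-- The Ricci tensor at `x`. -/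
def ricciAt (x : M) : Matrix (Fin n) (Fin n) ℝ := ricciMatrix x (extChartAt (𝓡 n) x x)

/-- The Hessian of `f` at `x`. -/
def hessianAt (f : M → ℝ) (x : M) : Matrix (Fin n) (Fin n) ℝ :=
  hessianMatrix f x (extChartAt (𝓡 n) x x)

/-- The tensor `df ⊗ df` at `x`. -/
def dfAt (f : M → ℝ) (x : M) : Matrix (Fin n) (Fin n) ℝ := dfMatrix f x (extChartAt (𝓡 n) x x)

/-- The scalar curvature, `R = gⁱʲ Ricᵢⱼ`. -/
def scalarCurvature (x : M) : ℝ := ((metricAt n x)⁻¹ * ricciAt n x).trace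

/-- The Schouten tensor `A = (n - 2)⁻¹ (Ric - R / (2 (n - 1)) g)` at `x`. -/
def schoutenAt (x : M) : Matrix (Fin n) (Fin n) ℝ :=
  (1 / ((n : ℝ) - 2)) • (ricciAt n x - (scalarCurvature n x / (2 * ((n : ℝ) - 1))) • metricAt n x)

/-- The `σₖ`-curvature: the `k`-th elementary symmetric function of the eigenvalues, counted with
multiplicity, of the (`g`-self-adjoint) endomorphism `g⁻¹ A`. -/
def sigmaCurvature (k : ℕ) (x : M) : ℝ :=
  ((metricAt n x)⁻¹ * schoutenAt n x).charpoly.roots.esymm k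

/-- The Laplace-Beltrami operator `Δf = gⁱʲ ∇²ᵢⱼ f`. -/
def laplacian (f : M → ℝ) (x : M) : ℝ := ((metricAt n x)⁻¹ * hessianAt n f x).trace

/-- The gradient of `f` at `x`: the vector that represents `df` through the inner product `g`. -/
def riemannianGradient (f : M → ℝ) (x : M) : TangentSpace (𝓡 n) x :=
  haveI : FiniteDimensional ℝ (TangentSpace (𝓡 n) x) :=
    inferInstanceAs (FiniteDimensional ℝ (EuclideanSpace ℝ (Fin n)))
  haveI : CompleteSpace (TangentSpace (𝓡 n) x) :=
    FiniteDimensional.complete ℝ (TangentSpace (𝓡 n) x)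
  (InnerProductSpace.toDual ℝ (TangentSpace (𝓡 n) x)).symm (mvfderiv (𝓡 n) f x)

variable (M) in
/-- The Riemannian metric of `M`, together with the function `f` and the constants `m ≠ 0` and
`lam`, is a quasi `k`-Yamabe gradient soliton:
`∇²f - (1/m) df ⊗ df = (σₖ - lam) g`, with `f` smooth. -/
structure IsQuasiYamabeGradientSoliton (k : ℕ) (m lam : ℝ) (f : M → ℝ) : Prop where
  m_ne_zero : m ≠ 0
  smooth : ContMDiff (𝓡 n) 𝓘(ℝ, ℝ) ∞ f
  equation : ∀ x : M,
    hessianAt n f x - (1 / m) • dfAt n f x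
      = (sigmaCurvature n k x - lam) • metricAt n x

end Pointwise

section Volume

variable [RiemannianBundle (fun x : M ↦ TangentSpace (𝓡 n) x)] [MeasurableSpace M]

variable (n) in
/-- The Riemannian volume `√(det g) dy¹ ⋯ dyⁿ` on the domain of the chart around `c`, extended by
zero to `M`. -/
def chartVolume (c : M) : Measure M :=
  Measure.map (extChartAt (𝓡 n) c).symm
    ((volume.restrict (extChartAt (𝓡 n) c).target).withDensity
      fun y : EuclideanSpace ℝ (Fin n) ↦ ENNReal.ofReal √(metricMatrix c y).det)

variable (n M) in
/-- The Riemannian volume measure `dv_g`. By the change of variables formula the measures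
`chartVolume c` agree on the overlaps of the chart domains, so their supremum (the least measure
that dominates them all) is the one measure that restricts to each of them on its domain. -/
def riemannianVolume : Measure M := ⨆ c : M, chartVolume n c

variable (n) in
/-- The weighted measure `dμ = e^{-f/m} dv_g`. -/
def weightedVolume (m : ℝ) (f : M → ℝ) : Measure M :=
  (riemannianVolume n M).withDensity fun x ↦ ENNReal.ofReal (Real.exp (-f x / m))

end Volume

end QuasiYamabe

end

/-!
With the weight `φ = f / m`, the trace of the soliton equation reads `Δ_φ f = n (σₖ - λ)`, where
`Δ_φ f = Δf - ⟨∇φ, ∇f⟩` is the drift Laplacian, which is symmetric with respect to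
`dμ = e^{-φ} dv_g`. If `Δ_φ f ≥ 0`, test it against a cutoff `η` that is `1` on the ball `B(R)`,
`0` off `B(2 R)`, and Lipschitz with constant `1 / R` (`M` is complete, hence proper, so `η` has
compact support):
`∫_{B(R)} Δ_φ f dμ ≤ ∫ η Δ_φ f dμ = -∫ ⟨∇η, ∇f⟩ dμ ≤ 2 ∫_{M \ B(R)} d(x, x₀)⁻¹ |∇f| dμ → 0`,
because `R⁻¹ ≤ 2 d(x, x₀)⁻¹` where `∇η ≠ 0`. Hence `Δ_φ f = 0`.

A Lipschitz `η` is admissible: a smooth partition of unity splits it into functions supported in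
charts, where the identity is the divergence theorem for the compactly supported, almost everywhere
differentiable (Rademacher) vector field `η √(det g) e^{-φ} ∇f` of `ℝⁿ`.
-/

noncomputable section

namespace QuasiYamabe

open MeasureTheory Bundle

/-! ### Matrix-valued functions and partial derivatives -/

section MatrixCalculus

variable {ι E : Type*} [NormedAddCommGroup E] [NormedSpace ℝ E] {A B : E → Matrix ι ι ℝ} {y v : E}

/-- The derivative of a matrix-valued function in the direction `v`, entry by entry: matrices carry
no global norm. -/
def entrywiseFDeriv (A : E → Matrix ι ι ℝ) (y v : E) : Matrix ι ι ℝ :=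
  .of fun i j ↦ fderiv ℝ (fun z ↦ A z i j) y v

lemma entrywiseFDeriv_congr (h : A =ᶠ[nhds y] B) :
    entrywiseFDeriv A y v = entrywiseFDeriv B y v := by
  ext i j
  exact congrArg (fun L : E →L[ℝ] ℝ ↦ L v) (h.fun_comp (· i j)).fderiv_eq

variable [Fintype ι]

lemma entrywiseFDeriv_mul (hA : ∀ i j, DifferentiableAt ℝ (fun z ↦ A z i j) y)
    (hB : ∀ i j, DifferentiableAt ℝ (fun z ↦ B z i j) y) :
    entrywiseFDeriv (fun z ↦ A z * B z) y v
      = A y * entrywiseFDeriv B y v + entrywiseFDeriv A y v * B y := by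
  ext i j
  simp only [entrywiseFDeriv, Matrix.of_apply, Matrix.add_apply, Matrix.mul_apply]
  rw [fderiv_fun_sum fun k _ ↦ (hA i k).fun_mul (hB k j), ← Finset.sum_add_distrib]
  simp only [sum_apply, fderiv_fun_mul (hA i _) (hB _ j),
    add_apply, smul_apply, smul_eq_mul, mul_comm]

/-- With `B = G⁻¹` and `D i = ∂ᵢ G`, the left side is the divergence of the `j`-th column of
`√(det G) G⁻¹`, divided by `√(det G)`, and the right side is `-∑ a b, B a b * Γ j a b`. -/
lemma sum_half_trace_mul_sub {B : Matrix ι ι ℝ} {D : ι → Matrix ι ι ℝ} (hB : B.IsSymm)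
    (hD : ∀ i, (D i).IsSymm) (j : ι) :
    ∑ i, ((1 / 2) * (B * D i).trace * B i j - (B * D i * B) i j)
      = -∑ a, ∑ b, B a b * ((1 / 2) * ∑ s, B j s * (D a b s + D b a s - D s a b)) := by
  set S : (ι → ι → ι → ℝ) → ℝ := fun d ↦ ∑ a, ∑ b, ∑ s, B a b * (B j s * d a b s) with hS
  have htrace : ∑ i, (B * D i).trace * B i j = S fun a b s ↦ D s a b := by
    simp only [hS, Matrix.trace, Matrix.diag, Matrix.mul_apply, Finset.sum_mul]
    rw [Finset.sum_comm]
    refine Finset.sum_congr rfl fun a _ ↦ ?_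
    rw [Finset.sum_comm]
    refine Finset.sum_congr rfl fun b _ ↦ Finset.sum_congr rfl fun s _ ↦ ?_
    rw [(hD s).apply, hB.apply j s]
    ring
  have hprod : ∑ i, (B * D i * B) i j = S fun a b s ↦ D a b s := by
    simp only [hS, Matrix.mul_apply, Finset.sum_mul]
    refine Finset.sum_congr rfl fun a _ ↦ ?_
    rw [Finset.sum_comm]
    refine Finset.sum_congr rfl fun b _ ↦ Finset.sum_congr rfl fun s _ ↦ ?_
    rw [hB.apply j s]
    ring
  have hswap : S (fun a b s ↦ D b a s) = S fun a b s ↦ D a b s := by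
    simp only [hS]
    rw [Finset.sum_comm]
    refine Finset.sum_congr rfl fun a _ ↦ Finset.sum_congr rfl fun b _ ↦ ?_
    rw [hB.apply]
  have hright : ∑ a, ∑ b, B a b * ((1 / 2) * ∑ s, B j s * (D a b s + D b a s - D s a b))
      = (1 / 2) * (S (fun a b s ↦ D a b s) + S (fun a b s ↦ D b a s)
        - S fun a b s ↦ D s a b) := by
    simp only [hS, ← Finset.sum_add_distrib, ← Finset.sum_sub_distrib, Finset.mul_sum]
    refine Finset.sum_congr rfl fun a _ ↦ Finset.sum_congr rfl fun b _ ↦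
      Finset.sum_congr rfl fun s _ ↦ ?_
    ring
  rw [hright, hswap, Finset.sum_sub_distrib, hprod, ← htrace]
  simp only [mul_assoc, ← Finset.mul_sum]
  ring

variable [DecidableEq ι]

variable (ι) in
/-- The determinant as a continuous multilinear function of the rows; it brings the calculus of
multilinear maps to bear on determinants. -/
def detMultilinear : ContinuousMultilinearMap ℝ (fun _ : ι ↦ ι → ℝ) ℝ where
  toMultilinearMap := Matrix.detRowAlternating.toMultilinearMap
  cont := Continuous.matrix_det (A := Matrix.of) continuous_id

variable {k : WithTop ℕ∞} {s : Set E}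

lemma contDiffOn_det (hA : ∀ i j, ContDiffOn ℝ k (fun z ↦ A z i j) s) :
    ContDiffOn ℝ k (fun z ↦ (A z).det) s :=
  (detMultilinear ι).contDiff.comp_contDiffOn
    (contDiffOn_pi.2 fun i ↦ contDiffOn_pi.2 fun j ↦ hA i j)

lemma contDiffOn_inv_apply (hA : ∀ i j, ContDiffOn ℝ k (fun z ↦ A z i j) s)
    (hdet : ∀ z ∈ s, (A z).det ≠ 0) (i j : ι) : ContDiffOn ℝ k (fun z ↦ (A z)⁻¹ i j) s := by
  simp only [Matrix.inv_def, Matrix.smul_apply, Ring.inverse_eq_inv', smul_eq_mul,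
    Matrix.adjugate_apply]
  refine ((contDiffOn_det hA).inv hdet).mul (contDiffOn_det fun a b ↦ ?_)
  obtain rfl | h := eq_or_ne a j
  · simpa only [Matrix.updateRow_self] using contDiffOn_const
  · simpa only [Matrix.updateRow_ne h] using hA a b

lemma hasFDerivAt_det (hA : ∀ i j, DifferentiableAt ℝ (fun z ↦ A z i j) y) :
    HasFDerivAt (fun z ↦ (A z).det) (((detMultilinear ι).linearDeriv (A y)).comp
      (.pi fun i ↦ .pi fun j ↦ fderiv ℝ (fun z ↦ A z i j) y)) y :=
  ((detMultilinear ι).hasFDerivAt (A y)).comp y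
    (hasFDerivAt_pi.2 fun i ↦ hasFDerivAt_pi.2 fun j ↦ (hA i j).hasFDerivAt)

/-- Jacobi's formula. -/
lemma fderiv_det (hA : ∀ i j, DifferentiableAt ℝ (fun z ↦ A z i j) y) :
    fderiv ℝ (fun z ↦ (A z).det) y v = ((A y).adjugate * entrywiseFDeriv A y v).trace := by
  set A' := entrywiseFDeriv A y v
  calc fderiv ℝ (fun z ↦ (A z).det) y v = ∑ i, ((A y).updateRow i (A' i)).det := by
        rw [(hasFDerivAt_det hA).fderiv]
        exact (detMultilinear ι).linearDeriv_apply (A y) A'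
    _ = ∑ i, ((A y).adjugate.transpose.mulVec (A' i)) i := by
        simp only [← Matrix.cramer_transpose_apply, Matrix.cramer_eq_adjugate_mulVec,
          Matrix.adjugate_transpose]
    _ = ((A y).adjugate * A').trace := by
        rw [Matrix.trace_mul_comm]
        simp only [Matrix.trace, Matrix.diag, Matrix.mul_apply, Matrix.mulVec, dotProduct,
          Matrix.transpose_apply, mul_comm]

lemma fderiv_sqrt_det (hA : ∀ i j, DifferentiableAt ℝ (fun z ↦ A z i j) y)
    (hdet : 0 < (A y).det) :
    fderiv ℝ (fun z ↦ √(A z).det) y v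
      = √(A y).det * ((1 / 2) * ((A y)⁻¹ * entrywiseFDeriv A y v).trace) := by
  have hadj : (A y).adjugate = (A y).det • (A y)⁻¹ := by
    rw [Matrix.inv_def, Ring.inverse_eq_inv', smul_inv_smul₀ hdet.ne']
  have hdiff := (hasFDerivAt_det hA).differentiableAt
  have hsqrt : √(A y).det * √(A y).det = (A y).det := Real.mul_self_sqrt hdet.le
  have hpos : 0 < √(A y).det := Real.sqrt_pos.2 hdet
  rw [fderiv_sqrt hdiff hdet.ne', smul_apply, fderiv_det hA, hadj,
    Matrix.smul_mul, Matrix.trace_smul, smul_eq_mul, smul_eq_mul]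
  nth_rw 2 [← hsqrt]
  field_simp [hpos.ne']

lemma entrywiseFDeriv_inv (hA : ∀ i j, DifferentiableAt ℝ (fun z ↦ A z i j) y)
    (hB : ∀ i j, DifferentiableAt ℝ (fun z ↦ (A z)⁻¹ i j) y)
    (hdet : ∀ᶠ z in nhds y, (A z).det ≠ 0) :
    entrywiseFDeriv (fun z ↦ (A z)⁻¹) y v
      = -((A y)⁻¹ * entrywiseFDeriv A y v * (A y)⁻¹) := by
  have hunit : IsUnit (A y).det := hdet.self_of_nhds.isUnit
  have hone : (fun z ↦ A z * (A z)⁻¹) =ᶠ[nhds y] fun _ ↦ 1 := by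
    filter_upwards [hdet] with z hz using Matrix.mul_nonsing_inv _ hz.isUnit
  have hzero : A y * entrywiseFDeriv (fun z ↦ (A z)⁻¹) y v
      + entrywiseFDeriv A y v * (A y)⁻¹ = 0 := by
    rw [← entrywiseFDeriv_mul hA hB, entrywiseFDeriv_congr hone]
    ext i j
    simp [entrywiseFDeriv]
  rw [← Matrix.nonsing_inv_mul_cancel_left _ (entrywiseFDeriv (fun z ↦ (A z)⁻¹) y v) hunit,
    eq_neg_of_add_eq_zero_left hzero, Matrix.mul_neg, Matrix.mul_assoc]

lemma fderiv_sqrt_det_mul_inv_apply (hA : ∀ i j, DifferentiableAt ℝ (fun z ↦ A z i j) y)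
    (hB : ∀ i j, DifferentiableAt ℝ (fun z ↦ (A z)⁻¹ i j) y)
    (hdet : ∀ᶠ z in nhds y, 0 < (A z).det) (i j : ι) :
    fderiv ℝ (fun z ↦ √(A z).det * (A z)⁻¹ i j) y v
      = √(A y).det * ((1 / 2) * ((A y)⁻¹ * entrywiseFDeriv A y v).trace * (A y)⁻¹ i j
        - ((A y)⁻¹ * entrywiseFDeriv A y v * (A y)⁻¹) i j) := by
  have hpos := hdet.self_of_nhds
  have hinv : fderiv ℝ (fun z ↦ (A z)⁻¹ i j) y v
      = -((A y)⁻¹ * entrywiseFDeriv A y v * (A y)⁻¹) i j :=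
    congrFun₂ (entrywiseFDeriv_inv hA hB (hdet.mono fun z hz ↦ hz.ne')) i j
  rw [fderiv_fun_mul ((hasFDerivAt_det hA).differentiableAt.sqrt hpos.ne') (hB i j),
    add_apply, smul_apply, smul_apply,
    hinv, fderiv_sqrt_det hA hpos, smul_eq_mul, smul_eq_mul]
  ring

end MatrixCalculus

section PartialDerivatives

variable {n : ℕ} {s : Set (EuclideanSpace ℝ (Fin n))} {y : EuclideanSpace ℝ (Fin n)}

lemma partialDeriv_mul {u v : EuclideanSpace ℝ (Fin n) → ℝ} (i : Fin n)
    (hu : DifferentiableAt ℝ u y) (hv : DifferentiableAt ℝ v y) :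
    partialDeriv i (fun z ↦ u z * v z) y
      = u y * partialDeriv i v y + partialDeriv i u y * v y := by
  simp [partialDeriv, fderiv_fun_mul hu hv, mul_comm]

lemma partialDeriv_sum {κ : Type*} {t : Finset κ} {u : κ → EuclideanSpace ℝ (Fin n) → ℝ}
    (i : Fin n) (hu : ∀ a ∈ t, DifferentiableAt ℝ (u a) y) :
    partialDeriv i (fun z ↦ ∑ a ∈ t, u a z) y = ∑ a ∈ t, partialDeriv i (u a) y := by
  simp [partialDeriv, fderiv_fun_sum hu]

lemma partialDeriv_exp_neg {u : EuclideanSpace ℝ (Fin n) → ℝ} (i : Fin n)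
    (hu : DifferentiableAt ℝ u y) :
    partialDeriv i (fun z ↦ Real.exp (-u z)) y = -(Real.exp (-u y) * partialDeriv i u y) := by
  simp [partialDeriv, fderiv_exp hu.fun_neg]

lemma contDiffOn_partialDeriv {u : EuclideanSpace ℝ (Fin n) → ℝ} (hs : IsOpen s)
    (hu : ContDiffOn ℝ ∞ u s) (i : Fin n) : ContDiffOn ℝ ∞ (partialDeriv i u) s :=
  (hu.fderiv_of_isOpen hs (by simp)).clm_apply contDiffOn_const

lemma sum_smul_single (v : EuclideanSpace ℝ (Fin n)) :
    ∑ i, v i • EuclideanSpace.single i (1 : ℝ) = v := by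
  simpa using (EuclideanSpace.basisFun (Fin n) ℝ).sum_repr v

end PartialDerivatives

/-! ### The metric and the gradient in charts -/

section CoordinateFields

variable {n : ℕ} {M : Type*} [TopologicalSpace M] [ChartedSpace (EuclideanSpace ℝ (Fin n)) M]

lemma mfderiv_chart_symm_eq_sum (c : M) (y v : EuclideanSpace ℝ (Fin n)) :
    mfderiv (𝓡 n) (𝓡 n) (extChartAt (𝓡 n) c).symm y v = ∑ i, v i • coordField c y i := by
  set L : EuclideanSpace ℝ (Fin n) →L[ℝ] TangentSpace (𝓡 n) ((extChartAt (𝓡 n) c).symm y) :=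
    mfderiv (𝓡 n) (𝓡 n) (extChartAt (𝓡 n) c).symm y
  calc L v = L (∑ i, v i • EuclideanSpace.single i (1 : ℝ)) := by rw [sum_smul_single]
    _ = ∑ i, v i • L (EuclideanSpace.single i (1 : ℝ)) := by simp only [map_sum, map_smul]

lemma differentiableAt_of_contDiffOn_target {c : M} {y : EuclideanSpace ℝ (Fin n)}
    {u : EuclideanSpace ℝ (Fin n) → ℝ} (hu : ContDiffOn ℝ ∞ u (extChartAt (𝓡 n) c).target)
    (hy : y ∈ (extChartAt (𝓡 n) c).target) : DifferentiableAt ℝ u y :=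
  (hu.contDiffAt ((isOpen_extChartAt_target c).mem_nhds hy)).differentiableAt (by simp)

variable [RiemannianBundle (fun x : M ↦ TangentSpace (𝓡 n) x)]

lemma metricMatrix_isSymm (c : M) (y : EuclideanSpace ℝ (Fin n)) : (metricMatrix c y).IsSymm :=
  Matrix.IsSymm.ext fun i j ↦ real_inner_comm (coordField c y i) (coordField c y j)

lemma inv_metricMatrix_isSymm (c : M) (y : EuclideanSpace ℝ (Fin n)) :
    (metricMatrix c y)⁻¹.IsSymm := by
  rw [Matrix.IsSymm, Matrix.transpose_nonsing_inv, metricMatrix_isSymm]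

lemma inner_mfderiv_chart_symm (c : M) (y v w : EuclideanSpace ℝ (Fin n)) :
    inner ℝ (mfderiv (𝓡 n) (𝓡 n) (extChartAt (𝓡 n) c).symm y v)
      (mfderiv (𝓡 n) (𝓡 n) (extChartAt (𝓡 n) c).symm y w)
      = v.ofLp ⬝ᵥ (metricMatrix c y).mulVec w.ofLp := by
  simp only [mfderiv_chart_symm_eq_sum, sum_inner, inner_sum, real_inner_smul_left,
    real_inner_smul_right, dotProduct, Matrix.mulVec, metricMatrix, Matrix.of_apply,
    Finset.mul_sum]
  rw [Finset.sum_comm]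
  exact Finset.sum_congr rfl fun i _ ↦ Finset.sum_congr rfl fun j _ ↦ by ring

lemma norm_mfderiv_chart_symm (c : M) (y v : EuclideanSpace ℝ (Fin n)) :
    ‖mfderiv (𝓡 n) (𝓡 n) (extChartAt (𝓡 n) c).symm y v‖
      = √(v.ofLp ⬝ᵥ (metricMatrix c y).mulVec v.ofLp) := by
  rw [norm_eq_sqrt_real_inner]
  exact congrArg Real.sqrt (inner_mfderiv_chart_symm c y v v)

lemma inner_riemannianGradient (f : M → ℝ) (x : M) (X : TangentSpace (𝓡 n) x) :
    inner ℝ (riemannianGradient n f x) X = mvfderiv (𝓡 n) f x X := by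
  have : FiniteDimensional ℝ (TangentSpace (𝓡 n) x) :=
    inferInstanceAs (FiniteDimensional ℝ (EuclideanSpace ℝ (Fin n)))
  have : CompleteSpace (TangentSpace (𝓡 n) x) :=
    FiniteDimensional.complete ℝ (TangentSpace (𝓡 n) x)
  exact InnerProductSpace.toDual_symm_apply

variable (n) in
/-- The derivative `⟨∇f, ∇ψ⟩` of `ψ` in the direction of the gradient of `f`. -/
def gradDeriv (f ψ : M → ℝ) (x : M) : ℝ :=
  mvfderiv (𝓡 n) ψ x (riemannianGradient n f x)

lemma gradDeriv_self (f : M → ℝ) (x : M) :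
    gradDeriv n f f x = ‖riemannianGradient n f x‖ ^ 2 := by
  rw [gradDeriv, ← inner_riemannianGradient, real_inner_self_eq_norm_sq]

lemma gradDeriv_eq_zero_of_eventuallyEq_const {f ψ : M → ℝ} {x : M} {a : ℝ}
    (h : ψ =ᶠ[nhds x] fun _ ↦ a) : gradDeriv n f ψ x = 0 := by
  rw [gradDeriv, mvfderiv, h.mfderiv_eq, mfderiv_const]
  rfl

lemma gradDeriv_const_mul {f ψ : M → ℝ} {x : M} (hψ : MDifferentiableAt (𝓡 n) 𝓘(ℝ, ℝ) ψ x)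
    (a : ℝ) : gradDeriv n f (fun z ↦ a * ψ z) x = a * gradDeriv n f ψ x :=
  congrArg (fun L ↦ L (riemannianGradient n f x)) (const_smul_mfderiv hψ a)

end CoordinateFields

section ChartGeometry

variable {n : ℕ} {M : Type*} [TopologicalSpace M] [ChartedSpace (EuclideanSpace ℝ (Fin n)) M]
  [IsManifold (𝓡 n) ∞ M]

lemma isInvertible_mfderiv_chart_symm {c : M} {y : EuclideanSpace ℝ (Fin n)}
    (hy : y ∈ (extChartAt (𝓡 n) c).target) :
    (mfderiv (𝓡 n) (𝓡 n) (extChartAt (𝓡 n) c).symm y).IsInvertible := by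
  have : IsManifold (𝓡 n) 1 M := .of_le (n := ∞) (by simp)
  simpa [mfderivWithin_univ] using isInvertible_mfderivWithin_extChartAt_symm (I := 𝓡 n) hy

lemma mdifferentiableAt_chart_symm {c : M} {y : EuclideanSpace ℝ (Fin n)}
    (hy : y ∈ (extChartAt (𝓡 n) c).target) :
    MDifferentiableAt (𝓡 n) (𝓡 n) (extChartAt (𝓡 n) c).symm y :=
  ((contMDiffOn_extChartAt_symm (n := ∞) c).contMDiffAt
    ((isOpen_extChartAt_target c).mem_nhds hy)).mdifferentiableAt (by simp)

lemma contMDiffOn_coordField (c : M) (i : Fin n) :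
    ContMDiffOn (𝓡 n) ((𝓡 n).prod 𝓘(ℝ, EuclideanSpace ℝ (Fin n))) ∞
      (fun y ↦ (⟨(extChartAt (𝓡 n) c).symm y, coordField c y i⟩ : TangentBundle (𝓡 n) M))
      (extChartAt (𝓡 n) c).target := by
  have hopen := isOpen_extChartAt_target (I := 𝓡 n) c
  have htangent := (contMDiffOn_extChartAt_symm (I := 𝓡 n) (n := ∞) c)
    |>.contMDiffOn_tangentMapWithin (m := ∞) (by simp) hopen.uniqueMDiffOn
  have hconst : ContMDiffOn (𝓡 n) ((𝓡 n).prod 𝓘(ℝ, EuclideanSpace ℝ (Fin n))) ∞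
      (fun y ↦ (⟨y, (EuclideanSpace.single i (1 : ℝ) : EuclideanSpace ℝ (Fin n))⟩ :
        TangentBundle (𝓡 n) (EuclideanSpace ℝ (Fin n)))) (extChartAt (𝓡 n) c).target :=
    contMDiffOn_vectorSpace_iff_contDiffOn.2 contDiffOn_const
  refine (htangent.comp hconst fun y hy ↦ hy).congr fun y hy ↦ ?_
  simp only [Function.comp_def, tangentMapWithin, coordField]
  rw [mfderivWithin_of_mem_nhds (hopen.mem_nhds hy)]

lemma contDiffOn_inChart {f : M → ℝ} (hf : ContMDiff (𝓡 n) 𝓘(ℝ, ℝ) ∞ f) (c : M) :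
    ContDiffOn ℝ ∞ (inChart (n := n) c f) (extChartAt (𝓡 n) c).target :=
  contMDiffOn_iff_contDiffOn.1 (hf.comp_contMDiffOn (contMDiffOn_extChartAt_symm c))

lemma mdifferentiableAt_iff_inChart {c : M} {y : EuclideanSpace ℝ (Fin n)}
    (hy : y ∈ (extChartAt (𝓡 n) c).target) (ψ : M → ℝ) :
    MDifferentiableAt (𝓡 n) 𝓘(ℝ, ℝ) ψ ((extChartAt (𝓡 n) c).symm y)
      ↔ DifferentiableAt ℝ (inChart c ψ) y := by
  have : IsManifold (𝓡 n) 1 M := .of_le (n := ∞) (by simp)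
  rw [← mdifferentiableAt_iff_differentiableAt]
  refine ⟨fun h ↦ h.comp y (mdifferentiableAt_chart_symm hy), fun h ↦ ?_⟩
  have hx := (extChartAt (𝓡 n) c).map_target hy
  have hchart : MDifferentiableAt (𝓡 n) 𝓘(ℝ, EuclideanSpace ℝ (Fin n)) (extChartAt (𝓡 n) c)
      ((extChartAt (𝓡 n) c).symm y) :=
    mdifferentiableAt_extChartAt (by rwa [extChartAt_source] at hx)
  rw [← (extChartAt (𝓡 n) c).right_inv hy] at h
  refine (h.comp _ hchart).congr_of_eventuallyEq ?_
  filter_upwards [(isOpen_extChartAt_source c).mem_nhds hx] with z hz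
  exact congrArg ψ ((extChartAt (𝓡 n) c).left_inv hz).symm

lemma mvfderiv_mfderiv_chart_symm {c : M} {y : EuclideanSpace ℝ (Fin n)}
    (hy : y ∈ (extChartAt (𝓡 n) c).target) (ψ : M → ℝ) (v : EuclideanSpace ℝ (Fin n)) :
    mvfderiv (𝓡 n) ψ ((extChartAt (𝓡 n) c).symm y)
        (mfderiv (𝓡 n) (𝓡 n) (extChartAt (𝓡 n) c).symm y v)
      = fderiv ℝ (inChart c ψ) y v := by
  by_cases h : MDifferentiableAt (𝓡 n) 𝓘(ℝ, ℝ) ψ ((extChartAt (𝓡 n) c).symm y)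
  · have hcomp := mfderiv_comp y h (mdifferentiableAt_chart_symm hy)
    have hfderiv : mfderiv (𝓡 n) 𝓘(ℝ, ℝ) (ψ ∘ (extChartAt (𝓡 n) c).symm) y
        = fderiv ℝ (inChart c ψ) y := mfderiv_eq_fderiv
    rw [hfderiv] at hcomp
    rw [hcomp]
    rfl
  · rw [mvfderiv, mfderiv_zero_of_not_mdifferentiableAt h, fderiv_zero_of_not_differentiableAt
      ((mdifferentiableAt_iff_inChart hy ψ).not.1 h)]
    rfl

lemma mvfderiv_coordField {c : M} {y : EuclideanSpace ℝ (Fin n)}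
    (hy : y ∈ (extChartAt (𝓡 n) c).target) (ψ : M → ℝ) (i : Fin n) :
    mvfderiv (𝓡 n) ψ ((extChartAt (𝓡 n) c).symm y) (coordField c y i)
      = partialDeriv i (inChart c ψ) y :=
  mvfderiv_mfderiv_chart_symm hy ψ _

lemma mfderivWithin_chart_symm_lineMap {c : M} {y y' : EuclideanSpace ℝ (Fin n)} {t : ℝ}
    (ht : t ∈ Set.Icc (0 : ℝ) 1)
    (hy : ContinuousAffineMap.lineMap (R := ℝ) y y' t ∈ (extChartAt (𝓡 n) c).target) :
    mfderivWithin 𝓘(ℝ, ℝ) (𝓡 n)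
        ((extChartAt (𝓡 n) c).symm ∘ ContinuousAffineMap.lineMap (R := ℝ) y y')
        (Set.Icc 0 1) t (1 : ℝ)
      = mfderiv (𝓡 n) (𝓡 n) (extChartAt (𝓡 n) c).symm
        (ContinuousAffineMap.lineMap (R := ℝ) y y' t) (y' - y) := by
  have hline : HasFDerivWithinAt (ContinuousAffineMap.lineMap (R := ℝ) y y')
      ((1 : ℝ →L[ℝ] ℝ).smulRight (y' - y)) (Set.Icc 0 1) t :=
    (AffineMap.hasDerivAt_lineMap (𝕜 := ℝ) (a := y) (b := y') (x := t)).hasFDerivAt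
      |>.hasFDerivWithinAt
  have hunique := uniqueDiffOn_Icc (zero_lt_one (α := ℝ)) t ht
  rw [mfderiv_comp_mfderivWithin t (mdifferentiableAt_chart_symm hy)
    hline.differentiableWithinAt.mdifferentiableWithinAt hunique.uniqueMDiffWithinAt]
  have hderiv : mfderivWithin 𝓘(ℝ, ℝ) (𝓡 n) (ContinuousAffineMap.lineMap (R := ℝ) y y')
      (Set.Icc 0 1) t = _ := mfderivWithin_eq_fderivWithin.trans (hline.fderivWithin hunique)
  rw [hderiv]
  exact congrArg (mfderiv (𝓡 n) (𝓡 n) (extChartAt (𝓡 n) c).symm _) (one_smul ℝ (y' - y))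

variable [RiemannianBundle (fun x : M ↦ TangentSpace (𝓡 n) x)]

lemma posDef_metricMatrix {c : M} {y : EuclideanSpace ℝ (Fin n)}
    (hy : y ∈ (extChartAt (𝓡 n) c).target) : (metricMatrix c y).PosDef := by
  refine Matrix.PosDef.of_dotProduct_mulVec_pos ?_ fun v hv ↦ ?_
  · rw [Matrix.IsHermitian, Matrix.conjTranspose_eq_transpose_of_trivial, metricMatrix_isSymm]
  · refine lt_of_lt_of_eq (real_inner_self_pos.2 fun h0 ↦ hv ?_)
      (inner_mfderiv_chart_symm c y (WithLp.toLp 2 v) (WithLp.toLp 2 v))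
    exact congrArg WithLp.ofLp
      ((isInvertible_mfderiv_chart_symm hy).injective (h0.trans (map_zero _).symm))

lemma det_metricMatrix_pos {c : M} {y : EuclideanSpace ℝ (Fin n)}
    (hy : y ∈ (extChartAt (𝓡 n) c).target) : 0 < (metricMatrix c y).det :=
  (posDef_metricMatrix hy).det_pos

lemma gradDeriv_chart {c : M} {y : EuclideanSpace ℝ (Fin n)}
    (hy : y ∈ (extChartAt (𝓡 n) c).target) (f ψ : M → ℝ) :
    gradDeriv n f ψ ((extChartAt (𝓡 n) c).symm y)
      = ∑ i, ∑ j, (metricMatrix c y)⁻¹ i j * partialDeriv j (inChart c f) y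
          * partialDeriv i (inChart c ψ) y := by
  obtain ⟨v, hv⟩ : ∃ v : EuclideanSpace ℝ (Fin n),
      mfderiv (𝓡 n) (𝓡 n) (extChartAt (𝓡 n) c).symm y v
        = riemannianGradient n f ((extChartAt (𝓡 n) c).symm y) :=
    (isInvertible_mfderiv_chart_symm hy).surjective _
  have hdual : (metricMatrix c y).mulVec v.ofLp = fun j ↦ partialDeriv j (inChart c f) y := by
    ext j
    rw [← mvfderiv_coordField hy, ← inner_riemannianGradient, real_inner_comm, ← hv]
    refine Eq.trans ?_ (inner_mfderiv_chart_symm c y (EuclideanSpace.single j 1) v).symm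
    simp
  have hcoeff : v.ofLp = (metricMatrix c y)⁻¹.mulVec fun j ↦ partialDeriv j (inChart c f) y := by
    rw [← hdual, Matrix.mulVec_mulVec,
      Matrix.nonsing_inv_mul _ (det_metricMatrix_pos hy).ne'.isUnit, Matrix.one_mulVec]
  rw [gradDeriv, ← hv]
  refine (mvfderiv_mfderiv_chart_symm hy ψ v).trans ?_
  rw [← sum_smul_single v, map_sum]
  refine Finset.sum_congr rfl fun i _ ↦ ?_
  rw [map_smul, smul_eq_mul, congrFun hcoeff i, Matrix.mulVec, dotProduct, Finset.sum_mul]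
  rfl

variable [IsContMDiffRiemannianBundle (𝓡 n) ∞ (EuclideanSpace ℝ (Fin n))
      (fun x : M ↦ TangentSpace (𝓡 n) x)]

lemma contDiffOn_metricMatrix (c : M) (i j : Fin n) :
    ContDiffOn ℝ ∞ (fun y ↦ metricMatrix c y i j) (extChartAt (𝓡 n) c).target :=
  contMDiffOn_iff_contDiffOn.1 (ContMDiffOn.inner_bundle (F := EuclideanSpace ℝ (Fin n))
    (E := fun x : M ↦ TangentSpace (𝓡 n) x) (contMDiffOn_coordField c i)
    (contMDiffOn_coordField c j))

lemma contDiffOn_inv_metricMatrix (c : M) (i j : Fin n) :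
    ContDiffOn ℝ ∞ (fun y ↦ (metricMatrix c y)⁻¹ i j) (extChartAt (𝓡 n) c).target :=
  contDiffOn_inv_apply (contDiffOn_metricMatrix c) (fun _ hz ↦ (det_metricMatrix_pos hz).ne') i j

lemma contDiffOn_sqrt_det_metricMatrix (c : M) :
    ContDiffOn ℝ ∞ (fun y : EuclideanSpace ℝ (Fin n) ↦ √(metricMatrix c y).det)
      (extChartAt (𝓡 n) c).target :=
  (contDiffOn_det (contDiffOn_metricMatrix c)).sqrt fun _ hz ↦ (det_metricMatrix_pos hz).ne'

lemma contDiffOn_christoffel (c : M) (l i j : Fin n) :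
    ContDiffOn ℝ ∞ (christoffel c l i j) (extChartAt (𝓡 n) c).target := by
  have hd (a b e : Fin n) : ContDiffOn ℝ ∞ (partialDeriv a fun z ↦ metricMatrix c z b e)
      (extChartAt (𝓡 n) c).target :=
    contDiffOn_partialDeriv (isOpen_extChartAt_target c) (contDiffOn_metricMatrix c b e) a
  exact contDiffOn_const.mul (ContDiffOn.sum fun s _ ↦
    (contDiffOn_inv_metricMatrix c l s).mul (((hd i j s).add (hd j i s)).sub (hd s i j)))

lemma continuousOn_norm_mfderiv_chart_symm (c : M) (v : EuclideanSpace ℝ (Fin n)) :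
    ContinuousOn (fun y ↦ ‖mfderiv (𝓡 n) (𝓡 n) (extChartAt (𝓡 n) c).symm y v‖)
      (extChartAt (𝓡 n) c).target := by
  simp only [norm_mfderiv_chart_symm, dotProduct, Matrix.mulVec]
  exact (continuousOn_finsetSum _ fun i _ ↦ continuousOn_const.mul <|
    continuousOn_finsetSum _ fun j _ ↦
      (contDiffOn_metricMatrix c i j).continuousOn.mul continuousOn_const).sqrt

end ChartGeometry

/-! ### The drift Laplacian -/

section DriftLaplacian

variable {n : ℕ} {M : Type*} [TopologicalSpace M] [ChartedSpace (EuclideanSpace ℝ (Fin n)) M]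
  [RiemannianBundle (fun x : M ↦ TangentSpace (𝓡 n) x)]

variable (n) in
/-- The drift Laplacian `Δ_φ f = Δf - ⟨∇φ, ∇f⟩` of the weight `e^{-φ}`. -/
def driftLaplacian (φ f : M → ℝ) (x : M) : ℝ :=
  laplacian n f x - gradDeriv n f φ x

/-- The drift Laplacian `Δ_φ f`, computed in the chart around `c`. -/
def chartDriftLaplacian (φ f : M → ℝ) (c : M) (y : EuclideanSpace ℝ (Fin n)) : ℝ :=
  ((metricMatrix c y)⁻¹ * hessianMatrix f c y).trace
    - ∑ i, ∑ j, (metricMatrix c y)⁻¹ i j * partialDeriv j (inChart c f) y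
          * partialDeriv i (inChart c φ) y

/-- The components of the vector density `√(det g) e^{-φ} ∇f` in the chart around `c`. -/
def driftFlux (φ f : M → ℝ) (c : M) (i : Fin n) (y : EuclideanSpace ℝ (Fin n)) : ℝ :=
  ∑ j, (√(metricMatrix c y).det * (metricMatrix c y)⁻¹ i j)
    * (Real.exp (-inChart c φ y) * partialDeriv j (inChart c f) y)

variable [IsManifold (𝓡 n) ∞ M]

lemma driftLaplacian_eq_chart (φ f : M → ℝ) (x : M) :
    driftLaplacian n φ f x = chartDriftLaplacian φ f x (extChartAt (𝓡 n) x x) := by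
  have h := gradDeriv_chart (mem_extChartAt_target (I := 𝓡 n) x) f φ
  rw [extChartAt_to_inv] at h
  rw [driftLaplacian, h]
  rfl

variable [IsContMDiffRiemannianBundle (𝓡 n) ∞ (EuclideanSpace ℝ (Fin n))
      (fun x : M ↦ TangentSpace (𝓡 n) x)] {φ f : M → ℝ}

lemma contDiffOn_driftFlux (hφ : ContMDiff (𝓡 n) 𝓘(ℝ, ℝ) ∞ φ) (hf : ContMDiff (𝓡 n) 𝓘(ℝ, ℝ) ∞ f)
    (c : M) (i : Fin n) :
    ContDiffOn ℝ ∞ (driftFlux (n := n) φ f c i) (extChartAt (𝓡 n) c).target :=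
  ContDiffOn.sum fun j _ ↦ ((contDiffOn_sqrt_det_metricMatrix c).mul
    (contDiffOn_inv_metricMatrix c i j)).mul ((contDiffOn_inChart hφ c).neg.exp.mul
      (contDiffOn_partialDeriv (isOpen_extChartAt_target c) (contDiffOn_inChart hf c) j))

lemma continuousOn_chartDriftLaplacian (hφ : ContMDiff (𝓡 n) 𝓘(ℝ, ℝ) ∞ φ)
    (hf : ContMDiff (𝓡 n) 𝓘(ℝ, ℝ) ∞ f) (c : M) :
    ContinuousOn (chartDriftLaplacian (n := n) φ f c) (extChartAt (𝓡 n) c).target := by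
  have hopen := isOpen_extChartAt_target (I := 𝓡 n) c
  have hdφ := contDiffOn_partialDeriv hopen (contDiffOn_inChart hφ c)
  have hdf := contDiffOn_partialDeriv hopen (contDiffOn_inChart hf c)
  refine ContDiffOn.continuousOn (𝕜 := ℝ) (n := ∞) (ContDiffOn.sub ?_ ?_)
  · simp only [Matrix.trace, Matrix.diag, Matrix.mul_apply, hessianMatrix, Matrix.of_apply]
    exact ContDiffOn.sum fun i _ ↦ ContDiffOn.sum fun j _ ↦
      (contDiffOn_inv_metricMatrix c i j).mul ((contDiffOn_partialDeriv hopen (hdf i) j).sub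
        (ContDiffOn.sum fun l _ ↦ (contDiffOn_christoffel c l j i).mul (hdf l)))
  · exact ContDiffOn.sum fun i _ ↦ ContDiffOn.sum fun j _ ↦
      ((contDiffOn_inv_metricMatrix c i j).mul (hdf j)).mul (hdφ i)

lemma sum_partialDeriv_sqrt_det_mul_inv_metricMatrix {c : M} {y : EuclideanSpace ℝ (Fin n)}
    (hy : y ∈ (extChartAt (𝓡 n) c).target) (j : Fin n) :
    ∑ i, partialDeriv i (fun z ↦ √(metricMatrix c z).det * (metricMatrix c z)⁻¹ i j) y
      = -(√(metricMatrix c y).det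
        * ∑ a, ∑ b, (metricMatrix c y)⁻¹ a b * christoffel c j a b y) := by
  have hdet : ∀ᶠ z in nhds y, 0 < (metricMatrix c z).det := by
    filter_upwards [(isOpen_extChartAt_target (I := 𝓡 n) c).mem_nhds hy] with z hz
    exact det_metricMatrix_pos hz
  have hsymm (i : Fin n) :
      (entrywiseFDeriv (metricMatrix c) y (EuclideanSpace.single i 1)).IsSymm :=
    Matrix.IsSymm.ext fun a b ↦ by
      simp only [entrywiseFDeriv, Matrix.of_apply, (metricMatrix_isSymm c _).apply a b]
  simp only [partialDeriv, fderiv_sqrt_det_mul_inv_apply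
    (fun a b ↦ differentiableAt_of_contDiffOn_target (contDiffOn_metricMatrix c a b) hy)
    (fun a b ↦ differentiableAt_of_contDiffOn_target (contDiffOn_inv_metricMatrix c a b) hy) hdet,
    ← Finset.mul_sum]
  rw [sum_half_trace_mul_sub (inv_metricMatrix_isSymm c y) hsymm, mul_neg]
  rfl

/-- The density `√(det g)` turns the coordinate divergence of `gⁱʲ Wⱼ` into the trace of the
covariant derivative of `W`. -/
lemma sum_partialDeriv_sqrt_det_raise {W : Fin n → EuclideanSpace ℝ (Fin n) → ℝ} {c : M}
    {y : EuclideanSpace ℝ (Fin n)} (hy : y ∈ (extChartAt (𝓡 n) c).target)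
    (hW : ∀ j, DifferentiableAt ℝ (W j) y) :
    ∑ i, partialDeriv i (fun z ↦ ∑ j, √(metricMatrix c z).det * (metricMatrix c z)⁻¹ i j * W j z) y
      = √(metricMatrix c y).det * ∑ i, ∑ j, (metricMatrix c y)⁻¹ i j
          * (partialDeriv i (W j) y - ∑ l, christoffel c l i j y * W l y) := by
  have hdens (i j : Fin n) : DifferentiableAt ℝ
      (fun z ↦ √(metricMatrix c z).det * (metricMatrix c z)⁻¹ i j) y :=
    differentiableAt_of_contDiffOn_target
      ((contDiffOn_sqrt_det_metricMatrix c).mul (contDiffOn_inv_metricMatrix c i j)) hy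
  have hleibniz (i : Fin n) :
      partialDeriv i (fun z ↦ ∑ j, √(metricMatrix c z).det * (metricMatrix c z)⁻¹ i j * W j z) y
      = ∑ j, (√(metricMatrix c y).det * (metricMatrix c y)⁻¹ i j * partialDeriv i (W j) y
        + partialDeriv i (fun z ↦ √(metricMatrix c z).det * (metricMatrix c z)⁻¹ i j) y
          * W j y) := by
    rw [partialDeriv_sum i fun j _ ↦ (hdens i j).fun_mul (hW j)]
    exact Finset.sum_congr rfl fun j _ ↦ partialDeriv_mul i (hdens i j) (hW j)
  have hconnection : ∑ i, ∑ j,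
      partialDeriv i (fun z ↦ √(metricMatrix c z).det * (metricMatrix c z)⁻¹ i j) y * W j y
      = -(√(metricMatrix c y).det * ∑ i, ∑ j, (metricMatrix c y)⁻¹ i j
        * ∑ l, christoffel c l i j y * W l y) := by
    rw [Finset.sum_comm]
    simp only [← Finset.sum_mul, sum_partialDeriv_sqrt_det_mul_inv_metricMatrix hy]
    simp only [neg_mul, Finset.sum_neg_distrib, mul_assoc, ← Finset.mul_sum, neg_inj]
    congr 1
    simp only [Finset.mul_sum, Finset.sum_mul, mul_assoc]
    rw [Finset.sum_comm]
    exact Finset.sum_congr rfl fun a _ ↦ Finset.sum_comm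
  simp only [hleibniz, Finset.sum_add_distrib, hconnection]
  simp only [mul_sub, Finset.sum_sub_distrib, Finset.mul_sum, mul_assoc]
  ring

lemma sum_partialDeriv_driftFlux (hφ : ContMDiff (𝓡 n) 𝓘(ℝ, ℝ) ∞ φ)
    (hf : ContMDiff (𝓡 n) 𝓘(ℝ, ℝ) ∞ f) {c : M} {y : EuclideanSpace ℝ (Fin n)}
    (hy : y ∈ (extChartAt (𝓡 n) c).target) :
    ∑ i, partialDeriv i (driftFlux φ f c i) y
      = √(metricMatrix c y).det * Real.exp (-inChart c φ y) * chartDriftLaplacian φ f c y := by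
  have hφd := differentiableAt_of_contDiffOn_target (contDiffOn_inChart hφ c) hy
  have hfd (j : Fin n) : DifferentiableAt ℝ (partialDeriv j (inChart c f)) y :=
    differentiableAt_of_contDiffOn_target
      (contDiffOn_partialDeriv (isOpen_extChartAt_target c) (contDiffOn_inChart hf c) j) hy
  have hexp : DifferentiableAt ℝ (fun z ↦ Real.exp (-inChart c φ z)) y := hφd.fun_neg.exp
  have hcov (i j : Fin n) :
      partialDeriv i (fun z ↦ Real.exp (-inChart c φ z) * partialDeriv j (inChart c f) z) y
        - ∑ l, christoffel c l i j y
          * (Real.exp (-inChart c φ y) * partialDeriv l (inChart c f) y)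
      = Real.exp (-inChart c φ y) * (hessianMatrix f c y i j
        - partialDeriv j (inChart c f) y * partialDeriv i (inChart c φ) y) := by
    rw [partialDeriv_mul i hexp (hfd j), partialDeriv_exp_neg i hφd, hessianMatrix,
      Matrix.of_apply]
    simp only [mul_left_comm _ (Real.exp _), ← Finset.mul_sum]
    ring
  have htrace : ((metricMatrix c y)⁻¹ * hessianMatrix f c y).trace
      = ∑ i, ∑ j, (metricMatrix c y)⁻¹ i j * hessianMatrix f c y i j := by
    simp only [Matrix.trace, Matrix.diag, Matrix.mul_apply]
    rw [Finset.sum_comm]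
    simp only [(inv_metricMatrix_isSymm c y).apply]
  refine (sum_partialDeriv_sqrt_det_raise hy fun j ↦ hexp.fun_mul (hfd j)).trans ?_
  simp only [hcov]
  rw [chartDriftLaplacian, htrace, ← Finset.sum_sub_distrib, mul_assoc]
  simp only [← Finset.sum_sub_distrib, Finset.mul_sum]
  exact Finset.sum_congr rfl fun i _ ↦ Finset.sum_congr rfl fun j _ ↦ by ring

end DriftLaplacian

/-! ### Length spaces and the Riemannian distance -/

section LengthSpace

/-- A metric in which every distance splits, up to an arbitrarily small error, into prescribed
parts. For a complete metric space this says that it is a length space. -/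
def IsLengthMetric (M : Type*) [PseudoMetricSpace M] : Prop :=
  ∀ (x : M) (a b : ℝ), 0 ≤ a → 0 < b →
    Metric.ball x (a + b) ⊆ Metric.thickening b (Metric.closedBall x a)

variable {M : Type*} [PseudoMetricSpace M]

lemma IsLengthMetric.isCompact_closedBall_of_forall_lt [CompleteSpace M] (hM : IsLengthMetric M)
    {x : M} {r : ℝ} (hr : 0 < r) (h : ∀ s < r, IsCompact (Metric.closedBall x s)) :
    IsCompact (Metric.closedBall x r) := by
  refine isCompact_iff_totallyBounded_isComplete.2
    ⟨Metric.totallyBounded_iff.2 fun ε hε ↦ ?_, Metric.isClosed_closedBall.isComplete⟩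
  obtain ⟨δ, hδ, hδr, hδε⟩ : ∃ δ, 0 < δ ∧ δ ≤ r ∧ 2 * δ ≤ ε / 2 :=
    ⟨min r (ε / 4), by positivity, min_le_left _ _, by linarith [min_le_right r (ε / 4)]⟩
  obtain ⟨t, ht, hcover⟩ :=
    Metric.totallyBounded_iff.1 (h (r - δ) (by linarith)).totallyBounded (ε / 2) (by positivity)
  refine ⟨t, ht, fun y hy ↦ ?_⟩
  obtain ⟨z, hz, hyz⟩ := Metric.mem_thickening_iff.1
    (hM x (r - δ) (2 * δ) (by linarith) (by positivity)
      (Metric.closedBall_subset_ball (by linarith) hy))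
  obtain ⟨p, hp, hzp⟩ := Set.mem_iUnion₂.1 (hcover hz)
  refine Set.mem_iUnion₂.2 ⟨p, hp, Metric.mem_ball.2 ?_⟩
  linarith [dist_triangle y z p, Metric.mem_ball.1 hzp]

lemma IsLengthMetric.exists_gt_isCompact_closedBall [LocallyCompactSpace M]
    (hM : IsLengthMetric M) {x : M} {r : ℝ} (hr : 0 ≤ r) (h : IsCompact (Metric.closedBall x r)) :
    ∃ s > r, IsCompact (Metric.closedBall x s) := by
  obtain ⟨K, hK, hrK⟩ := exists_compact_superset h
  obtain ⟨δ, hδ, hδK⟩ := h.exists_thickening_subset_open isOpen_interior hrK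
  refine ⟨r + δ / 2, by linarith, hK.of_isClosed_subset Metric.isClosed_closedBall ?_⟩
  calc Metric.closedBall x (r + δ / 2) ⊆ Metric.ball x (r + δ) :=
        Metric.closedBall_subset_ball (by linarith)
    _ ⊆ Metric.thickening δ (Metric.closedBall x r) := hM x r δ hr hδ
    _ ⊆ K := hδK.trans interior_subset

/-- The Hopf–Rinow theorem for length spaces. -/
theorem IsLengthMetric.properSpace {M : Type*} [MetricSpace M] [CompleteSpace M]
    [LocallyCompactSpace M] (hM : IsLengthMetric M) : ProperSpace M := by
  refine .of_isCompact_closedBall_of_le 0 fun x R hR ↦ ?_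
  set S : Set ℝ := {r | IsCompact (Metric.closedBall x r)}
  have hdown {r s : ℝ} (hs : s ∈ S) (hrs : r ≤ s) : r ∈ S :=
    hs.of_isClosed_subset Metric.isClosed_closedBall (Metric.closedBall_subset_closedBall hrs)
  have hzero : (0 : ℝ) ∈ S := by simp [S]
  have hclosed : IsClosed (S ∩ Set.Icc 0 R) := by
    refine isClosed_of_closure_subset fun r hr ↦ ?_
    have hrR : r ∈ Set.Icc 0 R := isClosed_Icc.closure_subset_iff.2 Set.inter_subset_right hr
    refine ⟨?_, hrR⟩
    rcases hrR.1.eq_or_lt with rfl | hpos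
    · exact hzero
    · refine hM.isCompact_closedBall_of_forall_lt hpos fun s hs ↦ ?_
      obtain ⟨r', hr', hr'S⟩ := mem_closure_iff_nhds.1 hr _ (Ioi_mem_nhds hs)
      exact hdown hr'S.1 (le_of_lt hr')
  refine hclosed.Icc_subset_of_forall_exists_gt hzero (fun r hr s hs ↦ ?_) ⟨hR, le_rfl⟩
  obtain ⟨r', hr', hr'S⟩ := hM.exists_gt_isCompact_closedBall hr.2.1 hr.1
  exact ⟨min r' s, hdown hr'S (min_le_left _ _), lt_min hr' hs, min_le_right _ _⟩

end LengthSpace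

section RiemannianDistance

lemma isLengthMetric_of_isRiemannianManifold (n : ℕ) (M : Type*) [MetricSpace M]
    [ChartedSpace (EuclideanSpace ℝ (Fin n)) M]
    [RiemannianBundle (fun x : M ↦ TangentSpace (𝓡 n) x)] [IsRiemannianManifold (𝓡 n) M] :
    IsLengthMetric M := by
  intro x a b ha hb y hy
  rw [Metric.mem_ball'] at hy
  rcases le_or_gt (dist x y) a with hxy | hxy
  · exact Metric.self_subset_thickening hb _ (Metric.mem_closedBall'.2 hxy)
  have hedist : Manifold.riemannianEDist (𝓡 n) x y < ENNReal.ofReal (a + b) := by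
    rw [← IsRiemannianManifold.out (I := 𝓡 n) x y, edist_dist]
    exact (ENNReal.ofReal_lt_ofReal_iff (by positivity)).2 hy
  obtain ⟨γ, rfl, rfl, hγ, hlength⟩ := Manifold.exists_lt_of_riemannianEDist_lt hedist
  obtain ⟨t, ht, hta⟩ : ∃ t ∈ Set.Icc (0 : ℝ) 1, dist (γ 0) (γ t) = a :=
    intermediate_value_Icc zero_le_one
      ((continuous_const.dist continuous_id).comp_continuousOn hγ.continuousOn)
      ⟨by simpa using ha, hxy.le⟩
  have hedist_le {s s' : ℝ} (hs : 0 ≤ s) (hs' : s' ≤ 1) (hss' : s ≤ s') :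
      edist (γ s) (γ s') ≤ Manifold.pathELength (𝓡 n) γ s s' := by
    rw [IsRiemannianManifold.out (I := 𝓡 n)]
    exact Manifold.riemannianEDist_le_pathELength (hγ.mono (Set.Icc_subset_Icc hs hs')) rfl rfl hss'
  have hsum : edist (γ 0) (γ t) + edist (γ t) (γ 1) < ENNReal.ofReal (a + b) :=
    (add_le_add (hedist_le le_rfl ht.2 ht.1) (hedist_le ht.1 le_rfl ht.2)).trans_lt
      (by rwa [Manifold.pathELength_add ht.1 ht.2])
  rw [edist_dist, edist_dist, ← ENNReal.ofReal_add dist_nonneg dist_nonneg,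
    ENNReal.ofReal_lt_ofReal_iff (by positivity), hta, dist_comm (γ t)] at hsum
  exact Metric.mem_thickening_iff.2 ⟨γ t, Metric.mem_closedBall'.2 hta.le, by linarith⟩

theorem properSpace_of_isRiemannianManifold (n : ℕ) (M : Type*) [MetricSpace M]
    [ChartedSpace (EuclideanSpace ℝ (Fin n)) M]
    [RiemannianBundle (fun x : M ↦ TangentSpace (𝓡 n) x)] [IsRiemannianManifold (𝓡 n) M]
    [CompleteSpace M] : ProperSpace M := by
  have : LocallyCompactSpace M := Manifold.locallyCompact_of_finiteDimensional (𝓡 n)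
  exact (isLengthMetric_of_isRiemannianManifold n M).properSpace

variable {n : ℕ} {M : Type*} [MetricSpace M] [ChartedSpace (EuclideanSpace ℝ (Fin n)) M]
  [RiemannianBundle (fun x : M ↦ TangentSpace (𝓡 n) x)] [IsManifold (𝓡 n) ∞ M]
  [IsRiemannianManifold (𝓡 n) M]

lemma dist_chart_symm_le {c : M} {y y' : EuclideanSpace ℝ (Fin n)} {C : ℝ}
    (hseg : segment ℝ y y' ⊆ (extChartAt (𝓡 n) c).target)
    (hC : ∀ z ∈ segment ℝ y y',
      ‖mfderiv (𝓡 n) (𝓡 n) (extChartAt (𝓡 n) c).symm z (y' - y)‖ ≤ C) :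
    dist ((extChartAt (𝓡 n) c).symm y) ((extChartAt (𝓡 n) c).symm y') ≤ C := by
  have hC0 : 0 ≤ C := (norm_nonneg _).trans (hC y (left_mem_segment ℝ y y'))
  set line : ℝ →ᴬ[ℝ] EuclideanSpace ℝ (Fin n) := ContinuousAffineMap.lineMap y y'
  have hline (t : ℝ) (ht : t ∈ Set.Icc (0 : ℝ) 1) : line t ∈ segment ℝ y y' := by
    rw [segment_eq_image_lineMap]
    exact ⟨t, ht, rfl⟩
  have hsmooth : ContMDiffOn 𝓘(ℝ, ℝ) (𝓡 n) 1 ((extChartAt (𝓡 n) c).symm ∘ line) (Set.Icc 0 1) :=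
    ((contMDiffOn_extChartAt_symm (n := ∞) c).of_le (by simp)).comp
      (contMDiff_iff_contDiff.2 line.contDiff).contMDiffOn fun t ht ↦ hseg (hline t ht)
  rw [← ENNReal.ofReal_le_ofReal_iff hC0, ← edist_dist, IsRiemannianManifold.out (I := 𝓡 n)]
  calc Manifold.riemannianEDist (𝓡 n) ((extChartAt (𝓡 n) c).symm y) ((extChartAt (𝓡 n) c).symm y')
      ≤ Manifold.pathELength (𝓡 n) ((extChartAt (𝓡 n) c).symm ∘ line) 0 1 :=
        Manifold.riemannianEDist_le_pathELength hsmooth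
          (by simp [line, ContinuousAffineMap.coe_lineMap_eq])
          (by simp [line, ContinuousAffineMap.coe_lineMap_eq]) zero_le_one
    _ ≤ ∫⁻ _ in Set.Icc (0 : ℝ) 1, ENNReal.ofReal C := by
        rw [Manifold.pathELength_eq_lintegral_mfderivWithin_Icc]
        refine setLIntegral_mono' measurableSet_Icc fun t ht ↦ ?_
        rw [← ofReal_norm]
        refine ENNReal.ofReal_le_ofReal (le_of_eq_of_le (congrArg norm ?_) (hC _ (hline t ht)))
        exact mfderivWithin_chart_symm_lineMap ht (hseg (hline t ht))
    _ = ENNReal.ofReal C := by simp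

variable [IsContMDiffRiemannianBundle (𝓡 n) ∞ (EuclideanSpace ℝ (Fin n))
      (fun x : M ↦ TangentSpace (𝓡 n) x)]

lemma locallyLipschitzOn_chart_symm (c : M) :
    LocallyLipschitzOn (extChartAt (𝓡 n) c).target (extChartAt (𝓡 n) c).symm := by
  intro y hy
  have htarget := (isOpen_extChartAt_target (I := 𝓡 n) c).mem_nhds hy
  set S : EuclideanSpace ℝ (Fin n) → ℝ := fun z ↦ ∑ i, ‖coordField c z i‖
  have hS : ContinuousAt S y := (continuousOn_finsetSum _ fun i _ ↦
    continuousOn_norm_mfderiv_chart_symm c (EuclideanSpace.single i 1)).continuousAt htarget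
  have hnorm (z v : EuclideanSpace ℝ (Fin n)) :
      ‖mfderiv (𝓡 n) (𝓡 n) (extChartAt (𝓡 n) c).symm z v‖ ≤ S z * ‖v‖ := by
    rw [mfderiv_chart_symm_eq_sum, Finset.sum_mul]
    refine norm_sum_le_of_le _ fun i _ ↦ ?_
    rw [norm_smul, mul_comm]
    exact mul_le_mul_of_nonneg_left (PiLp.norm_apply_le v i) (norm_nonneg _)
  obtain ⟨ε, hε, hball⟩ := Metric.mem_nhds_iff.1
    (Filter.inter_mem htarget (hS.eventually (gt_mem_nhds (lt_add_one (S y)))))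
  refine ⟨(S y + 1).toNNReal, Metric.ball y ε,
    mem_nhdsWithin_of_mem_nhds (Metric.ball_mem_nhds y hε), ?_⟩
  refine LipschitzOnWith.of_dist_le_mul fun z hz w hw ↦ ?_
  have hseg : segment ℝ z w ⊆ Metric.ball y ε := (convex_ball y ε).segment_subset hz hw
  refine dist_chart_symm_le (hseg.trans fun p hp ↦ (hball hp).1) fun p hp ↦ ?_
  rw [dist_comm, dist_eq_norm]
  exact (hnorm p (w - z)).trans (mul_le_mul_of_nonneg_right
    ((hball (hseg hp)).2.le.trans (Real.le_coe_toNNReal _)) (norm_nonneg _))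

lemma locallyLipschitzOn_inChart {ψ : M → ℝ} {K : NNReal} (hψ : LipschitzWith K ψ) (c : M) :
    LocallyLipschitzOn (extChartAt (𝓡 n) c).target (inChart (n := n) c ψ) :=
  fun _ hy ↦
    let ⟨K', t, ht, hsymm⟩ := locallyLipschitzOn_chart_symm c hy
    ⟨K * K', t, ht, hψ.comp_lipschitzOnWith hsymm⟩

lemma eventually_dist_chart_symm_le {c : M} {y v : EuclideanSpace ℝ (Fin n)}
    (hy : y ∈ (extChartAt (𝓡 n) c).target) {N : ℝ}
    (hN : ‖mfderiv (𝓡 n) (𝓡 n) (extChartAt (𝓡 n) c).symm y v‖ < N) :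
    ∀ᶠ t in nhdsWithin (0 : ℝ) (Set.Ioi 0),
      dist ((extChartAt (𝓡 n) c).symm (y + t • v)) ((extChartAt (𝓡 n) c).symm y) ≤ t * N := by
  have htarget := (isOpen_extChartAt_target (I := 𝓡 n) c).mem_nhds hy
  have hnear := ((continuousOn_norm_mfderiv_chart_symm c v).continuousAt htarget).eventually
    (gt_mem_nhds hN)
  obtain ⟨ε, hε, hball⟩ := Metric.mem_nhds_iff.1 (Filter.inter_mem htarget hnear)
  have hline : Filter.Tendsto (fun t : ℝ ↦ y + t • v) (nhdsWithin 0 (Set.Ioi 0)) (nhds y) := by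
    have hcont : Continuous fun t : ℝ ↦ y + t • v := by fun_prop
    simpa using hcont.continuousAt.tendsto.mono_left (nhdsWithin_le_nhds (a := (0 : ℝ)))
  filter_upwards [hline (Metric.ball_mem_nhds y hε), self_mem_nhdsWithin] with t ht htpos
  have hseg : segment ℝ y (y + t • v) ⊆ Metric.ball y ε :=
    (convex_ball y ε).segment_subset (Metric.mem_ball_self hε) ht
  rw [dist_comm]
  refine dist_chart_symm_le (hseg.trans fun p hp ↦ (hball hp).1) fun p hp ↦ ?_
  have hsmul : mfderiv (𝓡 n) (𝓡 n) (extChartAt (𝓡 n) c).symm p (y + t • v - y)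
      = t • mfderiv (𝓡 n) (𝓡 n) (extChartAt (𝓡 n) c).symm p v := by
    rw [add_sub_cancel_left]
    exact map_smul (mfderiv (𝓡 n) (𝓡 n) (extChartAt (𝓡 n) c).symm p) t v
  rw [hsmul, norm_smul, Real.norm_of_nonneg (le_of_lt htpos)]
  exact mul_le_mul_of_nonneg_left (le_of_lt (hball (hseg hp)).2) (le_of_lt htpos)

lemma abs_fderiv_inChart_le_of_lipschitzWith {ψ : M → ℝ} {K : NNReal} (hψ : LipschitzWith K ψ)
    {c : M} {y : EuclideanSpace ℝ (Fin n)} (hy : y ∈ (extChartAt (𝓡 n) c).target)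
    (v : EuclideanSpace ℝ (Fin n)) :
    |fderiv ℝ (inChart c ψ) y v|
      ≤ K * ‖mfderiv (𝓡 n) (𝓡 n) (extChartAt (𝓡 n) c).symm y v‖ := by
  by_cases hdiff : DifferentiableAt ℝ (inChart c ψ) y
  swap
  · rw [fderiv_zero_of_not_differentiableAt hdiff, zero_apply, abs_zero]
    positivity
  have hlt (N : ℝ) (hN : ‖mfderiv (𝓡 n) (𝓡 n) (extChartAt (𝓡 n) c).symm y v‖ < N) :
      |fderiv ℝ (inChart c ψ) y v| ≤ K * N := by
    refine le_of_tendsto (hdiff.hasFDerivAt.hasLineDerivAt v).tendsto_slope_zero_right.abs ?_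
    filter_upwards [eventually_dist_chart_symm_le hy hN, self_mem_nhdsWithin] with t ht htpos
    rw [smul_eq_mul, abs_mul, abs_inv, abs_of_pos htpos, inv_mul_le_iff₀ htpos]
    calc |inChart c ψ (y + t • v) - inChart c ψ y|
        ≤ K * dist ((extChartAt (𝓡 n) c).symm (y + t • v)) ((extChartAt (𝓡 n) c).symm y) :=
          hψ.dist_le_mul _ _
      _ ≤ K * (t * N) := by gcongr
      _ = t * (K * N) := by ring
  have hcont : Continuous fun N : ℝ ↦ K * N := by fun_prop
  exact ge_of_tendsto (hcont.continuousWithinAt (s := Set.Ioi _))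
    (eventually_mem_nhdsWithin.mono hlt)

lemma abs_mvfderiv_le_of_lipschitzWith {ψ : M → ℝ} {K : NNReal} (hψ : LipschitzWith K ψ) (x : M)
    (X : TangentSpace (𝓡 n) x) : |mvfderiv (𝓡 n) ψ x X| ≤ K * ‖X‖ := by
  obtain ⟨c, y, hy, rfl⟩ : ∃ c, ∃ y ∈ (extChartAt (𝓡 n) c).target,
      (extChartAt (𝓡 n) c).symm y = x :=
    ⟨x, _, mem_extChartAt_target x, extChartAt_to_inv x⟩
  obtain ⟨v, rfl⟩ : ∃ v : EuclideanSpace ℝ (Fin n),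
      mfderiv (𝓡 n) (𝓡 n) (extChartAt (𝓡 n) c).symm y v = X :=
    (isInvertible_mfderiv_chart_symm hy).surjective X
  exact (congrArg abs (mvfderiv_mfderiv_chart_symm hy ψ v)).trans_le
    (abs_fderiv_inChart_le_of_lipschitzWith hψ hy v)

end RiemannianDistance

/-! ### The weighted volume measure -/

section ChartTransition

variable {n : ℕ} {M : Type*} [TopologicalSpace M] [ChartedSpace (EuclideanSpace ℝ (Fin n)) M]

variable (n) in
/-- The change of coordinates from the chart around `c` to the chart around `c'`. -/
def chartTransition (c c' : M) :
    PartialEquiv (EuclideanSpace ℝ (Fin n)) (EuclideanSpace ℝ (Fin n)) :=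
  (extChartAt (𝓡 n) c).symm.trans (extChartAt (𝓡 n) c')

lemma isOpen_chartTransition_source (c c' : M) : IsOpen (chartTransition n c c').source :=
  (continuousOn_extChartAt_symm c).isOpen_inter_preimage (isOpen_extChartAt_target c)
    (isOpen_extChartAt_source c')

lemma chartTransition_mem_target {c c' : M} {y : EuclideanSpace ℝ (Fin n)}
    (hy : y ∈ (chartTransition n c c').source) :
    chartTransition n c c' y ∈ (extChartAt (𝓡 n) c').target :=
  (extChartAt (𝓡 n) c').map_source hy.2

lemma chart_symm_chartTransition {c c' : M} {y : EuclideanSpace ℝ (Fin n)}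
    (hy : y ∈ (chartTransition n c c').source) :
    (extChartAt (𝓡 n) c').symm (chartTransition n c c' y) = (extChartAt (𝓡 n) c).symm y :=
  (extChartAt (𝓡 n) c').left_inv hy.2

lemma chartTransition_image {c c' : M} {A : Set M} (hc : A ⊆ (extChartAt (𝓡 n) c).source)
    (hc' : A ⊆ (extChartAt (𝓡 n) c').source) :
    chartTransition n c c' '' ((extChartAt (𝓡 n) c).target ∩ (extChartAt (𝓡 n) c).symm ⁻¹' A)
      = (extChartAt (𝓡 n) c').target ∩ (extChartAt (𝓡 n) c').symm ⁻¹' A := by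
  rw [← PartialEquiv.image_eq_target_inter_inv_preimage _ hc,
    ← PartialEquiv.image_eq_target_inter_inv_preimage _ hc', Set.image_image]
  exact Set.image_congr fun x hx ↦ congrArg _ ((extChartAt (𝓡 n) c).left_inv (hc hx))

lemma differentiableAt_chartTransition [IsManifold (𝓡 n) ∞ M] {c c' : M}
    {y : EuclideanSpace ℝ (Fin n)} (hy : y ∈ (chartTransition n c c').source) :
    DifferentiableAt ℝ (chartTransition n c c') y :=
  ((contDiffOn_ext_coord_change (n := ∞) c' c).contDiffAt
    ((isOpen_chartTransition_source c c').mem_nhds hy)).differentiableAt (by simp)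

lemma mfderiv_chart_symm_chartTransition [IsManifold (𝓡 n) ∞ M] {c c' : M}
    {y : EuclideanSpace ℝ (Fin n)} (hy : y ∈ (chartTransition n c c').source)
    (v : EuclideanSpace ℝ (Fin n)) :
    (mfderiv (𝓡 n) (𝓡 n) (extChartAt (𝓡 n) c).symm y v : EuclideanSpace ℝ (Fin n))
      = mfderiv (𝓡 n) (𝓡 n) (extChartAt (𝓡 n) c').symm (chartTransition n c c' y)
          (fderiv ℝ (chartTransition n c c') y v) := by
  have heq : (extChartAt (𝓡 n) c).symm
      =ᶠ[nhds y] (extChartAt (𝓡 n) c').symm ∘ chartTransition n c c' := by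
    filter_upwards [(isOpen_chartTransition_source c c').mem_nhds hy] with z hz
    exact (chart_symm_chartTransition hz).symm
  have hcomp := mfderiv_comp y (mdifferentiableAt_chart_symm (chartTransition_mem_target hy))
    (differentiableAt_chartTransition hy).mdifferentiableAt
  rw [heq.mfderiv_eq, hcomp, mfderiv_eq_fderiv]
  rfl

variable (n) in
/-- The Jacobian matrix of the change of coordinates from the chart around `c` to the chart
around `c'`. -/
def chartJacobian (c c' : M) (y : EuclideanSpace ℝ (Fin n)) : Matrix (Fin n) (Fin n) ℝ :=
  LinearMap.toMatrix (EuclideanSpace.basisFun (Fin n) ℝ).toBasis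
    (EuclideanSpace.basisFun (Fin n) ℝ).toBasis
    (fderiv ℝ (chartTransition n c c') y).toLinearMap

lemma chartJacobian_apply (c c' : M) (y : EuclideanSpace ℝ (Fin n)) (a i : Fin n) :
    chartJacobian n c c' y a i
      = fderiv ℝ (chartTransition n c c') y (EuclideanSpace.single i 1) a := by
  simp only [chartJacobian, LinearMap.toMatrix_apply, OrthonormalBasis.coe_toBasis,
    EuclideanSpace.basisFun_apply, OrthonormalBasis.coe_toBasis_repr_apply,
    EuclideanSpace.basisFun_repr, ContinuousLinearMap.coe_coe]

variable [RiemannianBundle (fun x : M ↦ TangentSpace (𝓡 n) x)]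

lemma inner_tangentSpace_congr {x x' : M} (h : x = x') {v w : TangentSpace (𝓡 n) x}
    {v' w' : TangentSpace (𝓡 n) x'} (hv : @Eq (EuclideanSpace ℝ (Fin n)) v v')
    (hw : @Eq (EuclideanSpace ℝ (Fin n)) w w') : inner ℝ v w = inner ℝ v' w' := by
  subst h
  exact congrArg₂ _ hv hw

lemma metricMatrix_eq_chartJacobian_mul [IsManifold (𝓡 n) ∞ M] {c c' : M}
    {y : EuclideanSpace ℝ (Fin n)} (hy : y ∈ (chartTransition n c c').source) :
    metricMatrix c y = (chartJacobian n c c' y).transpose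
      * metricMatrix c' (chartTransition n c c' y) * chartJacobian n c c' y := by
  ext i j
  have h : metricMatrix c y i j
      = (fderiv ℝ (chartTransition n c c') y (EuclideanSpace.single i 1)).ofLp ⬝ᵥ
        (metricMatrix c' (chartTransition n c c' y)).mulVec
          (fderiv ℝ (chartTransition n c c') y (EuclideanSpace.single j 1)).ofLp := by
    rw [← inner_mfderiv_chart_symm]
    exact inner_tangentSpace_congr (chart_symm_chartTransition hy).symm
      (mfderiv_chart_symm_chartTransition hy _) (mfderiv_chart_symm_chartTransition hy _)
  rw [h, Matrix.mul_assoc]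
  simp only [Matrix.mul_apply, Matrix.transpose_apply, chartJacobian_apply,
    dotProduct, Matrix.mulVec]

lemma sqrt_det_metricMatrix_eq_abs_det_mul [IsManifold (𝓡 n) ∞ M] {c c' : M}
    {y : EuclideanSpace ℝ (Fin n)} (hy : y ∈ (chartTransition n c c').source) :
    √(metricMatrix c y).det = |(fderiv ℝ (chartTransition n c c') y).det|
      * √(metricMatrix c' (chartTransition n c c' y)).det := by
  rw [metricMatrix_eq_chartJacobian_mul hy, Matrix.det_mul, Matrix.det_mul, Matrix.det_transpose,
    chartJacobian, LinearMap.det_toMatrix, mul_right_comm, Real.sqrt_mul (mul_self_nonneg _),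
    Real.sqrt_mul_self_eq_abs]

end ChartTransition

section Volume

lemma iSup_restrict_le {α ι : Type*} [MeasurableSpace α] {μ : ι → Measure α} {ν : Measure α}
    {s : Set α} (hs : MeasurableSet s) (h : ∀ i, (μ i).restrict s ≤ ν) :
    (⨆ i, μ i).restrict s ≤ ν := by
  have hle : ⨆ i, μ i ≤ ν + (⨆ i, μ i).restrict sᶜ := iSup_le fun i ↦ by
    rw [← Measure.restrict_add_restrict_compl (μ := μ i) hs]
    exact add_le_add (h i) (Measure.restrict_mono subset_rfl (le_iSup μ i))
  calc (⨆ i, μ i).restrict s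
      ≤ (ν + (⨆ i, μ i).restrict sᶜ).restrict s := Measure.restrict_mono subset_rfl hle
    _ = ν.restrict s := by
        rw [Measure.restrict_add, Measure.restrict_restrict hs, Set.inter_compl_self,
          Measure.restrict_empty, add_zero]
    _ ≤ ν := Measure.restrict_le_self

lemma map_withDensity_comp {α β : Type*} [MeasurableSpace α] [MeasurableSpace β] {ν : Measure α}
    [SFinite ν] {g : α → β} (hg : AEMeasurable g ν) {e : β → ℝ≥0∞} (he : Measurable e) :
    (ν.map g).withDensity e = (ν.withDensity (e ∘ g)).map g := by
  ext A hA
  rw [withDensity_apply _ hA, Measure.restrict_map_of_aemeasurable hg hA,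
    lintegral_map' he.aemeasurable (hg.mono_measure Measure.restrict_le_self),
    Measure.map_apply_of_aemeasurable (hg.mono_ac (withDensity_absolutelyContinuous _ _)) hA,
    withDensity_apply']
  rfl

variable {n : ℕ} {M : Type*} [TopologicalSpace M] [ChartedSpace (EuclideanSpace ℝ (Fin n)) M]
  [MeasurableSpace M] [BorelSpace M]

lemma aemeasurable_chart_symm (c : M) : AEMeasurable (extChartAt (𝓡 n) c).symm
    (volume.restrict (extChartAt (𝓡 n) c).target) :=
  (continuousOn_extChartAt_symm c).aemeasurable (isOpen_extChartAt_target c).measurableSet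

lemma measurableSet_chart_target_inter_preimage (c : M) {A : Set M} (hA : MeasurableSet A) :
    MeasurableSet ((extChartAt (𝓡 n) c).target ∩ (extChartAt (𝓡 n) c).symm ⁻¹' A) := by
  have hcont := (continuousOn_extChartAt_symm (I := 𝓡 n) c).domRestrict
  convert (isOpen_extChartAt_target c).measurableSet.subtype_image (hcont.measurable hA) using 1
  ext x
  simp [and_comm]

variable [RiemannianBundle (fun x : M ↦ TangentSpace (𝓡 n) x)]

lemma chartVolume_apply (c : M) {A : Set M} (hA : MeasurableSet A) :
    chartVolume n c A = ∫⁻ y in (extChartAt (𝓡 n) c).target ∩ (extChartAt (𝓡 n) c).symm ⁻¹' A,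
      ENNReal.ofReal √(metricMatrix c y).det := by
  rw [chartVolume, Measure.map_apply_of_aemeasurable ((aemeasurable_chart_symm c).mono_ac
      (withDensity_absolutelyContinuous _ _)) hA, withDensity_apply',
    Measure.restrict_restrict' (isOpen_extChartAt_target c).measurableSet, Set.inter_comm]

lemma chartVolume_compl_source (c : M) : chartVolume n c (extChartAt (𝓡 n) c).sourceᶜ = 0 := by
  have hempty : (extChartAt (𝓡 n) c).target ∩ (extChartAt (𝓡 n) c).symm ⁻¹'
      (extChartAt (𝓡 n) c).sourceᶜ = ∅ :=
    Set.eq_empty_of_forall_notMem fun _ hy ↦ hy.2 ((extChartAt (𝓡 n) c).map_target hy.1)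
  rw [chartVolume_apply c (isOpen_extChartAt_source c).measurableSet.compl, hempty,
    Measure.restrict_empty, lintegral_zero_measure]

variable [IsManifold (𝓡 n) ∞ M]

lemma chartVolume_eq_of_subset {c c' : M} {A : Set M} (hA : MeasurableSet A)
    (hc : A ⊆ (extChartAt (𝓡 n) c).source) (hc' : A ⊆ (extChartAt (𝓡 n) c').source) :
    chartVolume n c A = chartVolume n c' A := by
  set S := (extChartAt (𝓡 n) c).target ∩ (extChartAt (𝓡 n) c).symm ⁻¹' A
  have hS : MeasurableSet S := measurableSet_chart_target_inter_preimage c hA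
  have hsub : S ⊆ (chartTransition n c c').source := fun y hy ↦ ⟨hy.1, hc' hy.2⟩
  rw [chartVolume_apply c hA, chartVolume_apply c' hA, ← chartTransition_image hc hc',
    lintegral_image_eq_lintegral_abs_det_fderiv_mul volume hS (fun y hy ↦
      (differentiableAt_chartTransition (hsub hy)).hasFDerivAt.hasFDerivWithinAt)
      ((chartTransition n c c').injOn.mono hsub)]
  refine setLIntegral_congr_fun hS fun y hy ↦ ?_
  rw [sqrt_det_metricMatrix_eq_abs_det_mul (hsub hy), ENNReal.ofReal_mul (abs_nonneg _)]

lemma chartVolume_restrict_source_le (c c' : M) :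
    (chartVolume n c').restrict (extChartAt (𝓡 n) c).source ≤ chartVolume n c :=
  Measure.le_iff.2 fun A hA ↦ by
    have hs := (isOpen_extChartAt_source (I := 𝓡 n) c).measurableSet
    have hs' := (isOpen_extChartAt_source (I := 𝓡 n) c').measurableSet
    calc (chartVolume n c').restrict (extChartAt (𝓡 n) c).source A
        = chartVolume n c' (A ∩ (extChartAt (𝓡 n) c).source ∩ (extChartAt (𝓡 n) c').source) := by
          rw [Measure.restrict_apply hA, measure_inter_conull (chartVolume_compl_source c')]
      _ = chartVolume n c (A ∩ (extChartAt (𝓡 n) c).source ∩ (extChartAt (𝓡 n) c').source) :=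
          chartVolume_eq_of_subset ((hA.inter hs).inter hs') Set.inter_subset_right
            (Set.inter_subset_left.trans Set.inter_subset_right)
      _ ≤ chartVolume n c A := measure_mono (Set.inter_subset_left.trans Set.inter_subset_left)

lemma riemannianVolume_restrict_source (c : M) :
    (riemannianVolume n M).restrict (extChartAt (𝓡 n) c).source = chartVolume n c := by
  have hs := (isOpen_extChartAt_source (I := 𝓡 n) c).measurableSet
  refine le_antisymm (iSup_restrict_le hs (chartVolume_restrict_source_le c)) ?_
  calc chartVolume n c
      = (chartVolume n c).restrict (extChartAt (𝓡 n) c).source :=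
        (Measure.restrict_eq_self_of_ae_mem (chartVolume_compl_source c)).symm
    _ ≤ (riemannianVolume n M).restrict (extChartAt (𝓡 n) c).source :=
        Measure.restrict_mono subset_rfl (le_iSup (fun c : M ↦ chartVolume n c) c)

end Volume

section DriftVolume

variable {n : ℕ} {M : Type*} [TopologicalSpace M] [ChartedSpace (EuclideanSpace ℝ (Fin n)) M]
  [RiemannianBundle (fun x : M ↦ TangentSpace (𝓡 n) x)]

variable (n) in
/-- The weighted measure `e^{-φ} dv_g`, with respect to which the drift Laplacian `Δ_φ` is
symmetric. -/
def driftVolume [MeasurableSpace M] (φ : M → ℝ) : Measure M :=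
  (riemannianVolume n M).withDensity fun x ↦ ENNReal.ofReal (Real.exp (-φ x))

/-- The density `e^{-φ} √(det g)` of the measure `driftVolume n φ` in the chart around `c`. -/
def driftDensity (φ : M → ℝ) (c : M) (y : EuclideanSpace ℝ (Fin n)) : ℝ :=
  √(metricMatrix c y).det * Real.exp (-inChart c φ y)

lemma driftDensity_nonneg (φ : M → ℝ) (c : M) (y : EuclideanSpace ℝ (Fin n)) :
    0 ≤ driftDensity φ c y :=
  mul_nonneg (Real.sqrt_nonneg _) (Real.exp_pos _).le

variable [IsManifold (𝓡 n) ∞ M]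

lemma driftDensity_pos (φ : M → ℝ) {c : M} {y : EuclideanSpace ℝ (Fin n)}
    (hy : y ∈ (extChartAt (𝓡 n) c).target) : 0 < driftDensity φ c y :=
  mul_pos (Real.sqrt_pos.2 (det_metricMatrix_pos hy)) (Real.exp_pos _)

variable [IsContMDiffRiemannianBundle (𝓡 n) ∞ (EuclideanSpace ℝ (Fin n))
      (fun x : M ↦ TangentSpace (𝓡 n) x)] {φ : M → ℝ}

lemma contDiffOn_driftDensity (hφ : ContMDiff (𝓡 n) 𝓘(ℝ, ℝ) ∞ φ) (c : M) :
    ContDiffOn ℝ ∞ (driftDensity (n := n) φ c) (extChartAt (𝓡 n) c).target :=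
  (contDiffOn_sqrt_det_metricMatrix c).mul (contDiffOn_inChart hφ c).neg.exp

variable [MeasurableSpace M] [BorelSpace M]

lemma aemeasurable_driftDensity (hφ : Measurable φ) (c : M) :
    AEMeasurable (driftDensity (n := n) φ c) (volume.restrict (extChartAt (𝓡 n) c).target) :=
  ((contDiffOn_sqrt_det_metricMatrix c).continuousOn.aemeasurable
    (isOpen_extChartAt_target c).measurableSet).mul
    (hφ.neg.exp.comp_aemeasurable (aemeasurable_chart_symm c))

lemma driftVolume_restrict_source (hφ : Measurable φ) (c : M) :
    (driftVolume n φ).restrict (extChartAt (𝓡 n) c).source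
      = ((volume.restrict (extChartAt (𝓡 n) c).target).withDensity
          fun y ↦ ENNReal.ofReal (driftDensity (n := n) φ c y)).map
            (extChartAt (𝓡 n) c).symm := by
  have hsqrt : AEMeasurable (fun y : EuclideanSpace ℝ (Fin n) ↦ √(metricMatrix c y).det)
      (volume.restrict (extChartAt (𝓡 n) c).target) :=
    (contDiffOn_sqrt_det_metricMatrix c).continuousOn.aemeasurable
      (isOpen_extChartAt_target c).measurableSet
  have hexp : Measurable fun x ↦ ENNReal.ofReal (Real.exp (-φ x)) := hφ.neg.exp.ennreal_ofReal
  rw [driftVolume, restrict_withDensity (isOpen_extChartAt_source c).measurableSet,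
    riemannianVolume_restrict_source, chartVolume, map_withDensity_comp
      ((aemeasurable_chart_symm c).mono_ac (withDensity_absolutelyContinuous _ _)) hexp,
    ← withDensity_mul₀ hsqrt.ennreal_ofReal (hexp.comp_aemeasurable (aemeasurable_chart_symm c))]
  simp only [driftDensity, ENNReal.ofReal_mul (Real.sqrt_nonneg _)]
  rfl

lemma map_chart_driftVolume_restrict_source (hφ : Measurable φ) (c : M) :
    ((driftVolume n φ).restrict (extChartAt (𝓡 n) c).source).map (extChartAt (𝓡 n) c)
      = (volume.restrict (extChartAt (𝓡 n) c).target).withDensity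
          fun y ↦ ENNReal.ofReal (driftDensity (n := n) φ c y) := by
  set ν := (volume.restrict (extChartAt (𝓡 n) c).target).withDensity
    fun y ↦ ENNReal.ofReal (driftDensity (n := n) φ c y)
  have hν : ν ≪ volume.restrict (extChartAt (𝓡 n) c).target :=
    withDensity_absolutelyContinuous _ _
  have hchart := (continuousOn_extChartAt (I := 𝓡 n) c).aemeasurable (μ := driftVolume n φ)
    (isOpen_extChartAt_source c).measurableSet
  have hinv : extChartAt (𝓡 n) c ∘ (extChartAt (𝓡 n) c).symm =ᵐ[ν] id :=
    hν.ae_le ((ae_restrict_mem (isOpen_extChartAt_target c).measurableSet).mono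
      fun y hy ↦ (extChartAt (𝓡 n) c).right_inv hy)
  rw [driftVolume_restrict_source hφ] at hchart ⊢
  rw [AEMeasurable.map_map_of_aemeasurable hchart ((aemeasurable_chart_symm c).mono_ac hν),
    Measure.map_congr hinv, Measure.map_id]

lemma ae_driftVolume_of_chart (hφ : Measurable φ) {c : M} {p : M → Prop}
    (h0 : ∀ x ∉ (extChartAt (𝓡 n) c).source, p x)
    (h : ∀ᵐ y, y ∈ (extChartAt (𝓡 n) c).target → p ((extChartAt (𝓡 n) c).symm y)) :
    ∀ᵐ x ∂(driftVolume n φ), p x := by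
  have hs := (isOpen_extChartAt_source (I := 𝓡 n) c).measurableSet
  have hmap : ∀ᵐ y ∂((driftVolume n φ).restrict (extChartAt (𝓡 n) c).source).map
      (extChartAt (𝓡 n) c), p ((extChartAt (𝓡 n) c).symm y) := by
    rw [map_chart_driftVolume_restrict_source hφ]
    exact (withDensity_absolutelyContinuous _ _).ae_le
      ((ae_restrict_iff' (isOpen_extChartAt_target c).measurableSet).2 h)
  have hsource := (ae_restrict_iff' hs).1
    (ae_of_ae_map ((continuousOn_extChartAt c).aemeasurable hs) hmap)
  filter_upwards [hsource] with x hx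
  by_cases hxs : x ∈ (extChartAt (𝓡 n) c).source
  · simpa only [(extChartAt (𝓡 n) c).left_inv hxs] using hx hxs
  · exact h0 x hxs

lemma integral_driftVolume_chart (hφ : Measurable φ) {c : M} {F : M → ℝ}
    (hF : AEStronglyMeasurable F (driftVolume n φ))
    (h0 : ∀ x ∉ (extChartAt (𝓡 n) c).source, F x = 0) :
    ∫ x, F x ∂(driftVolume n φ) = ∫ y in (extChartAt (𝓡 n) c).target,
      driftDensity φ c y * F ((extChartAt (𝓡 n) c).symm y) := by
  have hF' := hF.restrict (s := (extChartAt (𝓡 n) c).source)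
  rw [← setIntegral_eq_integral_of_forall_compl_eq_zero h0]
  rw [driftVolume_restrict_source hφ] at hF' ⊢
  rw [integral_map ((aemeasurable_chart_symm c).mono_ac (withDensity_absolutelyContinuous _ _)) hF',
    integral_withDensity_eq_integral_toReal_smul₀
      (aemeasurable_driftDensity hφ c).ennreal_ofReal (by simp)]
  simp only [ENNReal.toReal_ofReal (driftDensity_nonneg _ _ _), smul_eq_mul]

lemma aestronglyMeasurable_driftVolume_of_chart (hφ : Measurable φ) {c : M} {F : M → ℝ}
    (h0 : ∀ x ∉ (extChartAt (𝓡 n) c).source, F x = 0)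
    (h : AEStronglyMeasurable (fun y ↦ F ((extChartAt (𝓡 n) c).symm y))
      (volume.restrict (extChartAt (𝓡 n) c).target)) :
    AEStronglyMeasurable F (driftVolume n φ) := by
  have hs := (isOpen_extChartAt_source (I := 𝓡 n) c).measurableSet
  have hmap : AEStronglyMeasurable (fun y ↦ F ((extChartAt (𝓡 n) c).symm y))
      (((driftVolume n φ).restrict (extChartAt (𝓡 n) c).source).map (extChartAt (𝓡 n) c)) := by
    rw [map_chart_driftVolume_restrict_source hφ]
    exact h.mono_ac (withDensity_absolutelyContinuous _ _)
  rw [← Set.indicator_eq_self.2 (Function.support_subset_iff'.2 h0),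
    aestronglyMeasurable_indicator_iff hs]
  refine (hmap.comp_aemeasurable ((continuousOn_extChartAt c).aemeasurable hs)).congr ?_
  filter_upwards [ae_restrict_mem hs] with x hx
  simp only [Function.comp_apply, (extChartAt (𝓡 n) c).left_inv hx]

lemma integrable_driftVolume_chart (hφ : Measurable φ) {c : M} {F : M → ℝ}
    (h0 : ∀ x ∉ (extChartAt (𝓡 n) c).source, F x = 0)
    (hint : IntegrableOn (fun y ↦ driftDensity φ c y * F ((extChartAt (𝓡 n) c).symm y))
      (extChartAt (𝓡 n) c).target) :
    Integrable F (driftVolume n φ) := by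
  have ht := (isOpen_extChartAt_target (I := 𝓡 n) c).measurableSet
  have hF : AEStronglyMeasurable F (driftVolume n φ) := by
    refine aestronglyMeasurable_driftVolume_of_chart hφ h0
      ((((aemeasurable_driftDensity hφ c).inv.aestronglyMeasurable).mul
        hint.aestronglyMeasurable).congr ?_)
    filter_upwards [ae_restrict_mem ht] with y hy
    exact inv_mul_cancel_left₀ (driftDensity_pos φ hy).ne' _
  have hF' := hF.restrict (s := (extChartAt (𝓡 n) c).source)
  rw [← integrableOn_iff_integrable_of_support_subset
    (Function.support_subset_iff'.2 h0), IntegrableOn]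
  rw [driftVolume_restrict_source hφ] at hF' ⊢
  rw [integrable_map_measure hF'
      ((aemeasurable_chart_symm c).mono_ac (withDensity_absolutelyContinuous _ _)),
    integrable_withDensity_iff_integrable_smul₀'
      (aemeasurable_driftDensity hφ c).ennreal_ofReal (by simp)]
  simpa only [IntegrableOn, ENNReal.toReal_ofReal (driftDensity_nonneg _ _ _), smul_eq_mul,
    Function.comp_apply] using hint

end DriftVolume

/-! ### Integration by parts -/

section LocallyLipschitz

lemma locallyLipschitzOn_mul {X : Type*} [PseudoEMetricSpace X] {s : Set X} {u v : X → ℝ}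
    (hu : LocallyLipschitzOn s u) (hv : LocallyLipschitzOn s v) :
    LocallyLipschitzOn s fun x ↦ u x * v x := by
  rw [locallyLipschitzOn_iff_restrict] at hu hv ⊢
  exact (contDiff_mul (𝕜 := ℝ) (𝔸 := ℝ) (n := 1)).locallyLipschitz.comp (hu.prodMk hv)

lemma locallyLipschitzOn_of_contDiffOn {E F : Type*} [NormedAddCommGroup E] [NormedSpace ℝ E]
    [NormedAddCommGroup F] [NormedSpace ℝ F] {s : Set E} (hs : IsOpen s) {u : E → F}
    (hu : ContDiffOn ℝ 1 u s) : LocallyLipschitzOn s u := fun _ hx ↦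
  have ⟨K, t, ht, hK⟩ := (hu.contDiffAt (hs.mem_nhds hx)).exists_lipschitzOnWith
  ⟨K, t, mem_nhdsWithin_of_mem_nhds ht, hK⟩

lemma tsupport_indicator_subset {X Y : Type*} [TopologicalSpace X] [Zero Y] {s K : Set X}
    {u : X → Y} (hK : IsClosed K) (h0 : ∀ x ∈ s \ K, u x = 0) : tsupport (s.indicator u) ⊆ K :=
  closure_minimal (fun _ hx ↦ by_contra fun h ↦
    hx (Set.indicator_apply_eq_zero.2 fun hs ↦ h0 _ ⟨hs, h⟩)) hK

variable {X Y : Type*} [PseudoEMetricSpace X] [PseudoEMetricSpace Y] [Zero Y]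
  {s K : Set X} {u : X → Y}

lemma locallyLipschitz_indicator (hs : IsOpen s) (hu : LocallyLipschitzOn s u) (hK : IsClosed K)
    (hKs : K ⊆ s) (h0 : ∀ x ∈ s \ K, u x = 0) : LocallyLipschitz (s.indicator u) := by
  intro x
  by_cases hx : x ∈ s
  · obtain ⟨C, t, ht, hC⟩ := hu hx
    rw [nhdsWithin_eq_nhds.2 (hs.mem_nhds hx)] at ht
    refine ⟨C, t ∩ s, Filter.inter_mem ht (hs.mem_nhds hx), fun a ha b hb ↦ ?_⟩
    rw [Set.indicator_of_mem ha.2, Set.indicator_of_mem hb.2]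
    exact hC ha.1 hb.1
  · have hzero : ∀ a ∈ Kᶜ, s.indicator u a = 0 := fun a ha ↦
      Set.indicator_apply_eq_zero.2 fun has ↦ h0 a ⟨has, ha⟩
    refine ⟨0, Kᶜ, hK.isOpen_compl.mem_nhds fun h ↦ hx (hKs h), fun a ha b hb ↦ ?_⟩
    simp only [hzero a ha, hzero b hb, edist_self, zero_le]

lemma exists_lipschitzWith_of_hasCompactSupport {X F : Type*} [PseudoMetricSpace X]
    [ProperSpace X] [SeminormedAddCommGroup F] {u : X → F} (hu : LocallyLipschitz u)
    (hc : HasCompactSupport u) : ∃ C, LipschitzWith C u := by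
  obtain ⟨B, hB⟩ := hc.exists_bound_of_continuous hu.continuous
  obtain ⟨C, hC⟩ := (hu.locallyLipschitzOn (s := Metric.cthickening 1 (tsupport u))
    ).exists_lipschitzOnWith_of_compact hc.isCompact.cthickening
  have key : ∀ x y, x ∈ tsupport u → dist (u x) (u y) ≤ max (C : ℝ) (2 * B) * dist x y := by
    intro x y hx
    by_cases hy : y ∈ Metric.cthickening 1 (tsupport u)
    · exact (hC.dist_le_mul x (Metric.self_subset_cthickening _ hx) y hy).trans
        (by gcongr; exact le_max_left _ _)
    · have hdist : 1 ≤ dist x y := by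
        by_contra! h
        exact hy (Metric.mem_cthickening_of_dist_le y x 1 _ hx (by rw [dist_comm]; exact h.le))
      calc dist (u x) (u y) ≤ ‖u x‖ + ‖u y‖ := dist_le_norm_add_norm _ _
        _ ≤ 2 * B := by linarith [hB x, hB y]
        _ ≤ max (C : ℝ) (2 * B) * 1 := by rw [mul_one]; exact le_max_right _ _
        _ ≤ max (C : ℝ) (2 * B) * dist x y := by gcongr
  refine ⟨(max (C : ℝ) (2 * B)).toNNReal, LipschitzWith.of_dist_le_mul fun x y ↦ ?_⟩
  rw [Real.coe_toNNReal _ (le_max_of_le_left C.coe_nonneg)]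
  by_cases hx : x ∈ tsupport u
  · exact key x y hx
  by_cases hy : y ∈ tsupport u
  · rw [dist_comm, dist_comm x]
    exact key y x hy
  · rw [image_eq_zero_of_notMem_tsupport hx, image_eq_zero_of_notMem_tsupport hy, dist_self]
    positivity

variable {E : Type*} [NormedAddCommGroup E] [NormedSpace ℝ E]
  [MeasurableSpace E] [BorelSpace E] {μ : Measure E} [μ.IsAddHaarMeasure] {C : NNReal} {u : E → ℝ}

lemma integrable_fderiv_apply (hu : LipschitzWith C u) (hc : HasCompactSupport u) (v : E) :
    Integrable (fun y ↦ fderiv ℝ u y v) μ := by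
  have hbound : ∀ y, ‖fderiv ℝ u y v‖ ≤ C * ‖v‖ := fun y ↦
    (ContinuousLinearMap.le_opNorm _ v).trans
      (mul_le_mul_of_nonneg_right (norm_fderiv_le_of_lipschitz ℝ hu) (norm_nonneg v))
  refine (Measure.integrableOn_of_bounded (hc.isCompact.measure_lt_top (μ := μ)).ne
    (measurable_fderiv_apply_const ℝ u v).aestronglyMeasurable
    (Filter.Eventually.of_forall hbound)).integrable_of_forall_notMem_eq_zero fun y hy ↦ ?_
  rw [fderiv_of_notMem_tsupport ℝ hy, zero_apply]

lemma integral_fderiv_apply_eq_zero [FiniteDimensional ℝ E] (hu : LipschitzWith C u)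
    (hc : HasCompactSupport u) (v : E) :
    ∫ y, fderiv ℝ u y v ∂μ = 0 := by
  have hline : ∀ᵐ y ∂μ, lineDeriv ℝ u y (-v) * 1 = -fderiv ℝ u y v := by
    filter_upwards [hu.ae_differentiableAt] with y hy
    rw [hy.lineDeriv_eq_fderiv, map_neg, mul_one]
  have hconst := LipschitzWith.integral_lineDeriv_mul_eq (μ := μ)
    (LipschitzWith.const (1 : ℝ) : LipschitzWith 0 fun _ : E ↦ (1 : ℝ)) hu hc v
  rw [integral_congr_ae hline, integral_neg] at hconst
  simpa only [lineDeriv, deriv_const, zero_mul, integral_zero, zero_eq_neg] using hconst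

end LocallyLipschitz

section ChartTest

variable {n : ℕ} {M : Type*} [TopologicalSpace M]
  [ChartedSpace (EuclideanSpace ℝ (Fin n)) M] {c : M} {ψ : M → ℝ}

/-- The test functions in a chart: functions on `M` that are compactly supported in the domain of
the chart around `c` and locally Lipschitz in the coordinates. -/
structure IsChartTest (c : M) (ψ : M → ℝ) : Prop where
  hasCompactSupport : HasCompactSupport ψ
  tsupport_subset : tsupport ψ ⊆ (extChartAt (𝓡 n) c).source
  locallyLipschitzOn : LocallyLipschitzOn (extChartAt (𝓡 n) c).target (inChart (n := n) c ψ)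

namespace IsChartTest

lemma eventuallyEq_zero (hψ : IsChartTest (n := n) c ψ) {x : M}
    (hx : x ∉ (extChartAt (𝓡 n) c).source) : ψ =ᶠ[nhds x] fun _ ↦ 0 :=
  notMem_tsupport_iff_eventuallyEq.1 fun h ↦ hx (hψ.tsupport_subset h)

lemma isCompact_image_tsupport (hψ : IsChartTest (n := n) c ψ) :
    IsCompact (extChartAt (𝓡 n) c '' tsupport ψ) :=
  hψ.hasCompactSupport.isCompact.image_of_continuousOn
    ((continuousOn_extChartAt c).mono hψ.tsupport_subset)

lemma image_tsupport_subset (hψ : IsChartTest (n := n) c ψ) :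
    extChartAt (𝓡 n) c '' tsupport ψ ⊆ (extChartAt (𝓡 n) c).target :=
  Set.image_subset_iff.2 fun _ hx ↦ (extChartAt (𝓡 n) c).map_source (hψ.tsupport_subset hx)

end IsChartTest

lemma inChart_eq_zero_of_notMem_image_tsupport {y : EuclideanSpace ℝ (Fin n)}
    (hy : y ∈ (extChartAt (𝓡 n) c).target \ extChartAt (𝓡 n) c '' tsupport ψ) :
    inChart (n := n) c ψ y = 0 :=
  image_eq_zero_of_notMem_tsupport (f := ψ) fun h ↦
    hy.2 ⟨_, h, (extChartAt (𝓡 n) c).right_inv hy.1⟩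

/-- The local representative of `ψ` in the chart around `c`, multiplied by `h` and extended by
zero to the whole of `ℝⁿ`. -/
def chartExtension (c : M) (ψ : M → ℝ) (h : EuclideanSpace ℝ (Fin n) → ℝ) :
    EuclideanSpace ℝ (Fin n) → ℝ :=
  (extChartAt (𝓡 n) c).target.indicator fun y ↦ inChart c ψ y * h y

lemma chartExtension_eventuallyEq {y : EuclideanSpace ℝ (Fin n)}
    (hy : y ∈ (extChartAt (𝓡 n) c).target) (h : EuclideanSpace ℝ (Fin n) → ℝ) :
    chartExtension c ψ h =ᶠ[nhds y] fun z ↦ inChart c ψ z * h z := by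
  filter_upwards [(isOpen_extChartAt_target c).mem_nhds hy] with z hz
  exact Set.indicator_of_mem hz _

namespace IsChartTest

lemma tsupport_chartExtension_subset (hψ : IsChartTest (n := n) c ψ)
    (h : EuclideanSpace ℝ (Fin n) → ℝ) :
    tsupport (chartExtension c ψ h) ⊆ extChartAt (𝓡 n) c '' tsupport ψ :=
  tsupport_indicator_subset hψ.isCompact_image_tsupport.isClosed fun y hy ↦ by
    rw [inChart_eq_zero_of_notMem_image_tsupport hy, zero_mul]

lemma hasCompactSupport_chartExtension (hψ : IsChartTest (n := n) c ψ)
    (h : EuclideanSpace ℝ (Fin n) → ℝ) : HasCompactSupport (chartExtension c ψ h) :=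
  hψ.isCompact_image_tsupport.of_isClosed_subset (isClosed_tsupport _)
    (hψ.tsupport_chartExtension_subset h)

lemma exists_lipschitzWith_chartExtension (hψ : IsChartTest (n := n) c ψ)
    {h : EuclideanSpace ℝ (Fin n) → ℝ} (hh : ContDiffOn ℝ 1 h (extChartAt (𝓡 n) c).target) :
    ∃ C, LipschitzWith C (chartExtension c ψ h) := by
  have hto := isOpen_extChartAt_target (I := 𝓡 n) c
  refine exists_lipschitzWith_of_hasCompactSupport (locallyLipschitz_indicator hto
    (locallyLipschitzOn_mul hψ.locallyLipschitzOn (locallyLipschitzOn_of_contDiffOn hto hh))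
    hψ.isCompact_image_tsupport.isClosed hψ.image_tsupport_subset fun y hy ↦ ?_)
    (hψ.hasCompactSupport_chartExtension h)
  rw [inChart_eq_zero_of_notMem_image_tsupport hy, zero_mul]

lemma ae_differentiableAt (hψ : IsChartTest (n := n) c ψ) :
    ∀ᵐ y, y ∈ (extChartAt (𝓡 n) c).target → DifferentiableAt ℝ (inChart (n := n) c ψ) y := by
  obtain ⟨C, hC⟩ := hψ.exists_lipschitzWith_chartExtension (contDiffOn_const (c := (1 : ℝ)))
  filter_upwards [hC.ae_differentiableAt] with y hy hyt
  simpa only [mul_one] using hy.congr_of_eventuallyEq (chartExtension_eventuallyEq hyt _).symm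

end IsChartTest

variable [IsManifold (𝓡 n) ∞ M] [RiemannianBundle (fun x : M ↦ TangentSpace (𝓡 n) x)]
  [IsContMDiffRiemannianBundle (𝓡 n) ∞ (EuclideanSpace ℝ (Fin n))
      (fun x : M ↦ TangentSpace (𝓡 n) x)] {φ f : M → ℝ}

namespace IsChartTest

/-- The coordinate form of `div (ψ e^{-φ} ∇f) = e^{-φ} (ψ Δ_φ f + ⟨∇f, ∇ψ⟩)`. -/
lemma ae_sum_partialDeriv_chartExtension (hψ : IsChartTest (n := n) c ψ)
    (hφ : ContMDiff (𝓡 n) 𝓘(ℝ, ℝ) ∞ φ) (hf : ContMDiff (𝓡 n) 𝓘(ℝ, ℝ) ∞ f) :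
    ∀ᵐ y ∂(volume.restrict (extChartAt (𝓡 n) c).target),
      ∑ i, partialDeriv i (chartExtension c ψ (driftFlux φ f c i)) y
        = driftDensity φ c y * (inChart c ψ y * chartDriftLaplacian φ f c y)
          + driftDensity φ c y * gradDeriv n f ψ ((extChartAt (𝓡 n) c).symm y) := by
  have hto := isOpen_extChartAt_target (I := 𝓡 n) c
  rw [ae_restrict_iff' hto.measurableSet]
  filter_upwards [hψ.ae_differentiableAt] with y hd hy
  have hleibniz : ∀ i, partialDeriv i (chartExtension c ψ (driftFlux φ f c i)) y
      = inChart c ψ y * partialDeriv i (driftFlux φ f c i) y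
        + partialDeriv i (inChart c ψ) y * driftFlux φ f c i y := fun i ↦ by
    rw [partialDeriv, (chartExtension_eventuallyEq hy _).fderiv_eq]
    exact partialDeriv_mul i (hd hy)
      (((contDiffOn_driftFlux hφ hf c i).contDiffAt (hto.mem_nhds hy)).differentiableAt (by simp))
  simp only [hleibniz, Finset.sum_add_distrib, ← Finset.mul_sum]
  rw [sum_partialDeriv_driftFlux hφ hf hy, gradDeriv_chart hy, driftDensity]
  congr 1
  · ring
  · simp only [driftFlux, Finset.mul_sum]
    exact Finset.sum_congr rfl fun i _ ↦ Finset.sum_congr rfl fun j _ ↦ by ring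

lemma integrable_partialDeriv_chartExtension (hψ : IsChartTest (n := n) c ψ)
    (hφ : ContMDiff (𝓡 n) 𝓘(ℝ, ℝ) ∞ φ) (hf : ContMDiff (𝓡 n) 𝓘(ℝ, ℝ) ∞ f) (i : Fin n) :
    Integrable (partialDeriv i (chartExtension c ψ (driftFlux φ f c i))) :=
  have ⟨_, hC⟩ := hψ.exists_lipschitzWith_chartExtension
    ((contDiffOn_driftFlux hφ hf c i).of_le (by simp))
  integrable_fderiv_apply hC (hψ.hasCompactSupport_chartExtension _) _

lemma setIntegral_sum_partialDeriv_chartExtension (hψ : IsChartTest (n := n) c ψ)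
    (hφ : ContMDiff (𝓡 n) 𝓘(ℝ, ℝ) ∞ φ) (hf : ContMDiff (𝓡 n) 𝓘(ℝ, ℝ) ∞ f) :
    ∫ y in (extChartAt (𝓡 n) c).target,
      ∑ i, partialDeriv i (chartExtension c ψ (driftFlux φ f c i)) y = 0 := by
  rw [setIntegral_eq_integral_of_forall_compl_eq_zero, integral_finsetSum _ fun i _ ↦
    hψ.integrable_partialDeriv_chartExtension hφ hf i]
  · refine Finset.sum_eq_zero fun i _ ↦ ?_
    obtain ⟨C, hC⟩ := hψ.exists_lipschitzWith_chartExtension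
      ((contDiffOn_driftFlux hφ hf c i).of_le (by simp))
    exact integral_fderiv_apply_eq_zero hC (hψ.hasCompactSupport_chartExtension _) _
  · refine fun y hy ↦ Finset.sum_eq_zero fun i _ ↦ ?_
    rw [partialDeriv, fderiv_of_notMem_tsupport ℝ fun h ↦ hy (hψ.image_tsupport_subset
      (hψ.tsupport_chartExtension_subset _ h)), zero_apply]

lemma integrableOn_mul_chartDriftLaplacian (hψ : IsChartTest (n := n) c ψ)
    (hφ : ContMDiff (𝓡 n) 𝓘(ℝ, ℝ) ∞ φ) (hf : ContMDiff (𝓡 n) 𝓘(ℝ, ℝ) ∞ f) :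
    IntegrableOn (fun y ↦ driftDensity φ c y * (inChart c ψ y * chartDriftLaplacian φ f c y))
      (extChartAt (𝓡 n) c).target := by
  have hcont : ContinuousOn
      (fun y ↦ driftDensity φ c y * (inChart c ψ y * chartDriftLaplacian φ f c y))
      (extChartAt (𝓡 n) c).target :=
    (contDiffOn_driftDensity hφ c).continuousOn.mul
      (hψ.locallyLipschitzOn.continuousOn.mul (continuousOn_chartDriftLaplacian hφ hf c))
  refine ((hcont.mono hψ.image_tsupport_subset).integrableOn_compact
    hψ.isCompact_image_tsupport).of_forall_sdiff_eq_zero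
      (isOpen_extChartAt_target c).measurableSet fun y hy ↦ ?_
  rw [inChart_eq_zero_of_notMem_image_tsupport hy, zero_mul, mul_zero]

lemma integrableOn_gradDeriv (hψ : IsChartTest (n := n) c ψ)
    (hφ : ContMDiff (𝓡 n) 𝓘(ℝ, ℝ) ∞ φ) (hf : ContMDiff (𝓡 n) 𝓘(ℝ, ℝ) ∞ f) :
    IntegrableOn (fun y ↦ driftDensity φ c y * gradDeriv n f ψ ((extChartAt (𝓡 n) c).symm y))
      (extChartAt (𝓡 n) c).target := by
  have hdiv : Integrable fun y ↦ ∑ i, partialDeriv i (chartExtension c ψ (driftFlux φ f c i)) y :=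
    integrable_finsetSum _ fun i _ ↦ hψ.integrable_partialDeriv_chartExtension hφ hf i
  refine (hdiv.integrableOn.sub (hψ.integrableOn_mul_chartDriftLaplacian hφ hf)).congr ?_
  filter_upwards [hψ.ae_sum_partialDeriv_chartExtension hφ hf] with y hy
  rw [Pi.sub_apply, hy, add_sub_cancel_left]

variable [MeasurableSpace M] [BorelSpace M]

lemma ae_mdifferentiableAt (hψ : IsChartTest (n := n) c ψ) (hφ : Measurable φ) :
    ∀ᵐ x ∂(driftVolume n φ), MDifferentiableAt (𝓡 n) 𝓘(ℝ, ℝ) ψ x := by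
  refine ae_driftVolume_of_chart hφ (c := c) (fun x hx ↦
    mdifferentiableAt_const.congr_of_eventuallyEq (hψ.eventuallyEq_zero hx)) ?_
  filter_upwards [hψ.ae_differentiableAt] with y hy hyt
  exact (mdifferentiableAt_iff_inChart hyt ψ).2 (hy hyt)

lemma integrable_gradDeriv (hψ : IsChartTest (n := n) c ψ)
    (hφ : ContMDiff (𝓡 n) 𝓘(ℝ, ℝ) ∞ φ) (hf : ContMDiff (𝓡 n) 𝓘(ℝ, ℝ) ∞ f) :
    Integrable (gradDeriv n f ψ) (driftVolume n φ) :=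
  integrable_driftVolume_chart hφ.continuous.measurable (fun _ hx ↦
    gradDeriv_eq_zero_of_eventuallyEq_const (hψ.eventuallyEq_zero hx))
    (hψ.integrableOn_gradDeriv hφ hf)

lemma integrable_mul_chartDriftLaplacian (hψ : IsChartTest (n := n) c ψ)
    (hφ : ContMDiff (𝓡 n) 𝓘(ℝ, ℝ) ∞ φ) (hf : ContMDiff (𝓡 n) 𝓘(ℝ, ℝ) ∞ f) :
    Integrable (fun x ↦ ψ x * chartDriftLaplacian φ f c (extChartAt (𝓡 n) c x))
      (driftVolume n φ) := by
  refine integrable_driftVolume_chart hφ.continuous.measurable (fun x hx ↦ ?_)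
    ((hψ.integrableOn_mul_chartDriftLaplacian hφ hf).congr_fun (fun y hy ↦ ?_)
      (isOpen_extChartAt_target c).measurableSet)
  · rw [(hψ.eventuallyEq_zero hx).eq_of_nhds, zero_mul]
  · simp only [(extChartAt (𝓡 n) c).right_inv hy, inChart]

theorem integral_mul_chartDriftLaplacian (hψ : IsChartTest (n := n) c ψ)
    (hφ : ContMDiff (𝓡 n) 𝓘(ℝ, ℝ) ∞ φ) (hf : ContMDiff (𝓡 n) 𝓘(ℝ, ℝ) ∞ f) :
    ∫ x, ψ x * chartDriftLaplacian φ f c (extChartAt (𝓡 n) c x) ∂(driftVolume n φ)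
      = -∫ x, gradDeriv n f ψ x ∂(driftVolume n φ) := by
  have hφm := hφ.continuous.measurable
  have htm := (isOpen_extChartAt_target (I := 𝓡 n) c).measurableSet
  have hleft : ∫ x, ψ x * chartDriftLaplacian φ f c (extChartAt (𝓡 n) c x) ∂(driftVolume n φ)
      = ∫ y in (extChartAt (𝓡 n) c).target,
          driftDensity φ c y * (inChart c ψ y * chartDriftLaplacian φ f c y) := by
    rw [integral_driftVolume_chart hφm
      (hψ.integrable_mul_chartDriftLaplacian hφ hf).aestronglyMeasurable fun x hx ↦ by
        rw [(hψ.eventuallyEq_zero hx).eq_of_nhds, zero_mul]]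
    refine setIntegral_congr_fun htm fun y hy ↦ ?_
    simp only [(extChartAt (𝓡 n) c).right_inv hy, inChart]
  rw [hleft, integral_driftVolume_chart hφm
    (hψ.integrable_gradDeriv hφ hf).aestronglyMeasurable fun x hx ↦
      gradDeriv_eq_zero_of_eventuallyEq_const (hψ.eventuallyEq_zero hx), eq_neg_iff_add_eq_zero,
    ← integral_add (hψ.integrableOn_mul_chartDriftLaplacian hφ hf)
      (hψ.integrableOn_gradDeriv hφ hf),
    ← hψ.setIntegral_sum_partialDeriv_chartExtension hφ hf]
  exact (integral_congr_ae (hψ.ae_sum_partialDeriv_chartExtension hφ hf)).symm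

end IsChartTest

end ChartTest

section DriftMeasure

variable {n : ℕ} {M : Type*} [TopologicalSpace M] [ChartedSpace (EuclideanSpace ℝ (Fin n)) M]
  [RiemannianBundle (fun x : M ↦ TangentSpace (𝓡 n) x)] [IsManifold (𝓡 n) ∞ M]
  [IsContMDiffRiemannianBundle (𝓡 n) ∞ (EuclideanSpace ℝ (Fin n))
      (fun x : M ↦ TangentSpace (𝓡 n) x)] [MeasurableSpace M] [BorelSpace M] {φ : M → ℝ}

lemma isOpenPosMeasure_driftVolume (hφ : Measurable φ) : (driftVolume n φ).IsOpenPosMeasure := by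
  refine ⟨fun U hU ⟨x, hx⟩ h0 ↦ ?_⟩
  have hs := (isOpen_extChartAt_source (I := 𝓡 n) x).measurableSet
  set S := (extChartAt (𝓡 n) x).target ∩ (extChartAt (𝓡 n) x).symm ⁻¹' U
  have hSo : IsOpen S :=
    (continuousOn_extChartAt_symm x).isOpen_inter_preimage (isOpen_extChartAt_target x) hU
  have hSne : S.Nonempty := ⟨extChartAt (𝓡 n) x x, mem_extChartAt_target x, by
    rwa [Set.mem_preimage, extChartAt_to_inv]⟩
  have hsub : extChartAt (𝓡 n) x ⁻¹' S ∩ (extChartAt (𝓡 n) x).source ⊆ U := fun z hz ↦ by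
    simpa only [Set.mem_preimage, (extChartAt (𝓡 n) x).left_inv hz.2] using hz.1.2
  have hmap : (((driftVolume n φ).restrict (extChartAt (𝓡 n) x).source).map
      (extChartAt (𝓡 n) x)) S = 0 := by
    rw [Measure.map_apply_of_aemeasurable ((continuousOn_extChartAt x).aemeasurable hs)
      hSo.measurableSet, Measure.restrict_apply' hs]
    exact measure_mono_null hsub h0
  have hac : volume.restrict (extChartAt (𝓡 n) x).target
      ≪ (volume.restrict (extChartAt (𝓡 n) x).target).withDensity
        fun y ↦ ENNReal.ofReal (driftDensity φ x y) :=
    withDensity_absolutelyContinuous' (aemeasurable_driftDensity hφ x).ennreal_ofReal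
      ((ae_restrict_mem (isOpen_extChartAt_target x).measurableSet).mono fun y hy ↦
        (ENNReal.ofReal_pos.2 (driftDensity_pos φ hy)).ne')
  rw [map_chart_driftVolume_restrict_source hφ] at hmap
  have hvol := hac hmap
  rw [Measure.restrict_eq_self _ Set.inter_subset_left] at hvol
  exact hSo.measure_ne_zero volume hSne hvol

lemma isLocallyFiniteMeasure_driftVolume (hφ : ContMDiff (𝓡 n) 𝓘(ℝ, ℝ) ∞ φ) :
    IsLocallyFiniteMeasure (driftVolume n φ) := by
  refine ⟨fun x ↦ ?_⟩
  have hs := (isOpen_extChartAt_source (I := 𝓡 n) x).measurableSet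
  obtain ⟨K, hK, hKt, hKc⟩ := local_compact_nhds
    ((isOpen_extChartAt_target (I := 𝓡 n) x).mem_nhds (mem_extChartAt_target x))
  refine ⟨_, Filter.inter_mem (extChartAt_source_mem_nhds (I := 𝓡 n) x)
    ((continuousAt_extChartAt x).preimage_mem_nhds hK), ?_⟩
  calc driftVolume n φ ((extChartAt (𝓡 n) x).source ∩ extChartAt (𝓡 n) x ⁻¹' K)
      = (((driftVolume n φ).restrict (extChartAt (𝓡 n) x).source).map (extChartAt (𝓡 n) x)) K := by
        rw [Measure.map_apply_of_aemeasurable ((continuousOn_extChartAt x).aemeasurable hs)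
          hKc.measurableSet, Measure.restrict_apply' hs, Set.inter_comm]
    _ = ∫⁻ y in K, ENNReal.ofReal (driftDensity φ x y) := by
        rw [map_chart_driftVolume_restrict_source hφ.continuous.measurable, withDensity_apply _
          hKc.measurableSet, Measure.restrict_restrict hKc.measurableSet,
          Set.inter_eq_left.2 hKt]
    _ < ⊤ := (((contDiffOn_driftDensity hφ x).continuousOn.mono hKt).integrableOn_compact
        hKc).lintegral_lt_top

end DriftMeasure

section GlobalIntegrationByParts

variable {n : ℕ} {M : Type*} [TopologicalSpace M] [ChartedSpace (EuclideanSpace ℝ (Fin n)) M]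
  [IsManifold (𝓡 n) ∞ M] {c : M} {ψ η : M → ℝ}

lemma IsChartTest.of_contMDiff (hψ : ContMDiff (𝓡 n) 𝓘(ℝ, ℝ) ∞ ψ) (hc : HasCompactSupport ψ)
    (hs : tsupport ψ ⊆ (extChartAt (𝓡 n) c).source) : IsChartTest (n := n) c ψ :=
  ⟨hc, hs, locallyLipschitzOn_of_contDiffOn (isOpen_extChartAt_target c)
    ((contDiffOn_inChart hψ c).of_le (by simp))⟩

variable [RiemannianBundle (fun x : M ↦ TangentSpace (𝓡 n) x)] {φ f : M → ℝ}

lemma gradDeriv_sum {ι : Type*} {t : Finset ι} {ψ : ι → M → ℝ} {x : M}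
    (h : ∀ a ∈ t, MDifferentiableAt (𝓡 n) 𝓘(ℝ, ℝ) (ψ a) x) :
    gradDeriv n f (fun z ↦ ∑ a ∈ t, ψ a z) x = ∑ a ∈ t, gradDeriv n f (ψ a) x := by
  obtain ⟨c, y, hy, rfl⟩ : ∃ c, ∃ y ∈ (extChartAt (𝓡 n) c).target,
      (extChartAt (𝓡 n) c).symm y = x :=
    ⟨x, _, mem_extChartAt_target x, extChartAt_to_inv x⟩
  have hpartial : ∀ i, partialDeriv i (inChart c fun z ↦ ∑ a ∈ t, ψ a z) y
      = ∑ a ∈ t, partialDeriv i (inChart c (ψ a)) y := fun i ↦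
    partialDeriv_sum i fun a ha ↦ (mdifferentiableAt_iff_inChart hy _).1 (h a ha)
  simp only [gradDeriv_chart hy, hpartial, Finset.mul_sum]
  symm
  rw [Finset.sum_comm]
  exact Finset.sum_congr rfl fun _ _ ↦ Finset.sum_comm

variable [IsContMDiffRiemannianBundle (𝓡 n) ∞ (EuclideanSpace ℝ (Fin n))
      (fun x : M ↦ TangentSpace (𝓡 n) x)]

lemma continuousOn_chartDriftLaplacian_comp_chart (hφ : ContMDiff (𝓡 n) 𝓘(ℝ, ℝ) ∞ φ)
    (hf : ContMDiff (𝓡 n) 𝓘(ℝ, ℝ) ∞ f) (c : M) :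
    ContinuousOn (fun x ↦ chartDriftLaplacian φ f c (extChartAt (𝓡 n) c x))
      (extChartAt (𝓡 n) c).source :=
  (continuousOn_chartDriftLaplacian hφ hf c).comp (continuousOn_extChartAt c)
    fun _ hx ↦ (extChartAt (𝓡 n) c).map_source hx

variable [T2Space M] [SigmaCompactSpace M]

/-- Both sides integrate by parts in the same way against every test function supported in the
intersection of the two charts. -/
lemma chartDriftLaplacian_eq_of_mem_source (hφ : ContMDiff (𝓡 n) 𝓘(ℝ, ℝ) ∞ φ)
    (hf : ContMDiff (𝓡 n) 𝓘(ℝ, ℝ) ∞ f) {c c' x : M} (hx : x ∈ (extChartAt (𝓡 n) c).source)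
    (hx' : x ∈ (extChartAt (𝓡 n) c').source) :
    chartDriftLaplacian φ f c (extChartAt (𝓡 n) c x)
      = chartDriftLaplacian φ f c' (extChartAt (𝓡 n) c' x) := by
  borelize M
  have := isOpenPosMeasure_driftVolume (n := n) hφ.continuous.measurable
  have := isLocallyFiniteMeasure_driftVolume hφ
  set U := (extChartAt (𝓡 n) c).source ∩ (extChartAt (𝓡 n) c').source
  have hU : IsOpen U := (isOpen_extChartAt_source c).inter (isOpen_extChartAt_source c')
  have hcont := (continuousOn_chartDriftLaplacian_comp_chart hφ hf c).mono
    (Set.inter_subset_left : U ⊆ _)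
  have hcont' := (continuousOn_chartDriftLaplacian_comp_chart hφ hf c').mono
    (Set.inter_subset_right : U ⊆ _)
  have hae := hU.ae_eq_zero_of_integral_contMDiff_smul_eq_zero (𝓡 n) (μ := driftVolume n φ)
    ((hcont.sub hcont').locallyIntegrableOn hU.measurableSet) fun ψ hψ hψc hψU ↦ by
      have htest := IsChartTest.of_contMDiff hψ hψc (hψU.trans Set.inter_subset_left)
      have htest' := IsChartTest.of_contMDiff hψ hψc (hψU.trans Set.inter_subset_right)
      simp only [smul_eq_mul, Pi.sub_apply, mul_sub]
      rw [integral_sub (htest.integrable_mul_chartDriftLaplacian hφ hf)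
        (htest'.integrable_mul_chartDriftLaplacian hφ hf),
        htest.integral_mul_chartDriftLaplacian hφ hf,
        htest'.integral_mul_chartDriftLaplacian hφ hf, sub_self]
  refine Measure.eqOn_open_of_ae_eq (μ := driftVolume n φ) ?_ hU hcont hcont' ⟨hx, hx'⟩
  rw [Filter.EventuallyEq, ae_restrict_iff' hU.measurableSet]
  filter_upwards [hae] with z hz hzU using sub_eq_zero.1 (hz hzU)

lemma chartDriftLaplacian_eq (hφ : ContMDiff (𝓡 n) 𝓘(ℝ, ℝ) ∞ φ)
    (hf : ContMDiff (𝓡 n) 𝓘(ℝ, ℝ) ∞ f) {c x : M} (hx : x ∈ (extChartAt (𝓡 n) c).source) :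
    chartDriftLaplacian φ f c (extChartAt (𝓡 n) c x) = driftLaplacian n φ f x := by
  rw [driftLaplacian_eq_chart,
    chartDriftLaplacian_eq_of_mem_source hφ hf hx (mem_extChartAt_source x)]

lemma continuous_driftLaplacian (hφ : ContMDiff (𝓡 n) 𝓘(ℝ, ℝ) ∞ φ)
    (hf : ContMDiff (𝓡 n) 𝓘(ℝ, ℝ) ∞ f) : Continuous (driftLaplacian n φ f) := by
  refine continuous_iff_continuousAt.2 fun x ↦ ?_
  have hxs := extChartAt_source_mem_nhds (I := 𝓡 n) x
  refine ((continuousOn_chartDriftLaplacian_comp_chart hφ hf x).continuousAt hxs).congr ?_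
  filter_upwards [hxs] with z hz using chartDriftLaplacian_eq hφ hf hz

lemma IsChartTest.mul_chartDriftLaplacian_eq (hψ : IsChartTest (n := n) c ψ)
    (hφ : ContMDiff (𝓡 n) 𝓘(ℝ, ℝ) ∞ φ) (hf : ContMDiff (𝓡 n) 𝓘(ℝ, ℝ) ∞ f) (x : M) :
    ψ x * chartDriftLaplacian φ f c (extChartAt (𝓡 n) c x) = ψ x * driftLaplacian n φ f x := by
  by_cases hx : x ∈ (extChartAt (𝓡 n) c).source
  · rw [chartDriftLaplacian_eq hφ hf hx]
  · rw [(hψ.eventuallyEq_zero hx).eq_of_nhds, zero_mul, zero_mul]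

variable [MeasurableSpace M] [BorelSpace M]

lemma IsChartTest.integral_mul_driftLaplacian (hψ : IsChartTest (n := n) c ψ)
    (hφ : ContMDiff (𝓡 n) 𝓘(ℝ, ℝ) ∞ φ) (hf : ContMDiff (𝓡 n) 𝓘(ℝ, ℝ) ∞ f) :
    ∫ x, ψ x * driftLaplacian n φ f x ∂(driftVolume n φ)
      = -∫ x, gradDeriv n f ψ x ∂(driftVolume n φ) := by
  simpa only [hψ.mul_chartDriftLaplacian_eq hφ hf] using
    hψ.integral_mul_chartDriftLaplacian hφ hf

lemma IsChartTest.integrable_mul_driftLaplacian (hψ : IsChartTest (n := n) c ψ)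
    (hφ : ContMDiff (𝓡 n) 𝓘(ℝ, ℝ) ∞ φ) (hf : ContMDiff (𝓡 n) 𝓘(ℝ, ℝ) ∞ f) :
    Integrable (fun x ↦ ψ x * driftLaplacian n φ f x) (driftVolume n φ) := by
  simpa only [hψ.mul_chartDriftLaplacian_eq hφ hf] using
    hψ.integrable_mul_chartDriftLaplacian hφ hf

lemma integrable_mul_driftLaplacian (hη : Continuous η) (hc : HasCompactSupport η)
    (hφ : ContMDiff (𝓡 n) 𝓘(ℝ, ℝ) ∞ φ) (hf : ContMDiff (𝓡 n) 𝓘(ℝ, ℝ) ∞ f) :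
    Integrable (fun x ↦ η x * driftLaplacian n φ f x) (driftVolume n φ) := by
  have := isLocallyFiniteMeasure_driftVolume hφ
  exact (hη.mul (continuous_driftLaplacian hφ hf)).integrable_of_hasCompactSupport hc.mul_right

end GlobalIntegrationByParts

section LipschitzTest

variable {n : ℕ} {M : Type*} [MetricSpace M] [ChartedSpace (EuclideanSpace ℝ (Fin n)) M]
  [IsManifold (𝓡 n) ∞ M]
  [RiemannianBundle (fun x : M ↦ TangentSpace (𝓡 n) x)]
  [IsContMDiffRiemannianBundle (𝓡 n) ∞ (EuclideanSpace ℝ (Fin n))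
      (fun x : M ↦ TangentSpace (𝓡 n) x)] [IsRiemannianManifold (𝓡 n) M]
  {χ η φ f : M → ℝ} {K : NNReal}

lemma IsChartTest.mul_lipschitzWith {c : M} (hχ : ContMDiff (𝓡 n) 𝓘(ℝ, ℝ) ∞ χ)
    (hs : tsupport χ ⊆ (extChartAt (𝓡 n) c).source) (hη : LipschitzWith K η)
    (hc : HasCompactSupport η) : IsChartTest (n := n) c fun x ↦ χ x * η x where
  hasCompactSupport := hc.mul_left
  tsupport_subset := (tsupport_mul_subset_left).trans hs
  locallyLipschitzOn := locallyLipschitzOn_mul (locallyLipschitzOn_of_contDiffOn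
    (isOpen_extChartAt_target c) ((contDiffOn_inChart hχ c).of_le (by simp)))
    (locallyLipschitzOn_inChart hη c)

lemma exists_sum_isChartTest [SigmaCompactSpace M] (hη : LipschitzWith K η)
    (hc : HasCompactSupport η) : ∃ (t : Finset M) (ψ : t → M → ℝ),
      (∀ c : t, IsChartTest (n := n) (c : M) (ψ c)) ∧ η = fun x ↦ ∑ c, ψ c x := by
  obtain ⟨t, ht⟩ := hc.isCompact.elim_finite_subcover
    (fun c : M ↦ (extChartAt (𝓡 n) c).source) (fun c ↦ isOpen_extChartAt_source c)
    (fun x _ ↦ Set.mem_iUnion.2 ⟨x, mem_extChartAt_source x⟩)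
  obtain ⟨χ, hχ⟩ := SmoothPartitionOfUnity.exists_isSubordinate (𝓡 n) (isClosed_tsupport η)
    (fun c : t ↦ (extChartAt (𝓡 n) (c : M)).source) (fun c ↦ isOpen_extChartAt_source _)
    (fun x hx ↦ by simpa using ht hx)
  refine ⟨t, fun c x ↦ χ c x * η x, fun c ↦
    IsChartTest.mul_lipschitzWith (χ c).contMDiff (hχ c) hη hc, funext fun x ↦ ?_⟩
  by_cases hx : x ∈ tsupport η
  · rw [← Finset.sum_mul, ← finsum_eq_sum_of_fintype, χ.sum_eq_one hx, one_mul]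
  · simp only [image_eq_zero_of_notMem_tsupport hx, mul_zero, Finset.sum_const_zero]

variable [MeasurableSpace M] [BorelSpace M] [SigmaCompactSpace M]

theorem integral_mul_driftLaplacian (hη : LipschitzWith K η) (hc : HasCompactSupport η)
    (hφ : ContMDiff (𝓡 n) 𝓘(ℝ, ℝ) ∞ φ) (hf : ContMDiff (𝓡 n) 𝓘(ℝ, ℝ) ∞ f) :
    ∫ x, η x * driftLaplacian n φ f x ∂(driftVolume n φ)
      = -∫ x, gradDeriv n f η x ∂(driftVolume n φ) := by
  obtain ⟨t, ψ, htest, rfl⟩ := exists_sum_isChartTest (n := n) hη hc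
  have hgrad : gradDeriv n f (fun x ↦ ∑ c, ψ c x) =ᵐ[driftVolume n φ]
      fun x ↦ ∑ c, gradDeriv n f (ψ c) x := by
    filter_upwards [ae_all_iff.2 fun c ↦ (htest c).ae_mdifferentiableAt hφ.continuous.measurable]
      with x hx using gradDeriv_sum fun c _ ↦ hx c
  simp only [Finset.sum_mul]
  rw [integral_congr_ae hgrad,
    integral_finsetSum _ fun c _ ↦ (htest c).integrable_mul_driftLaplacian hφ hf,
    integral_finsetSum _ fun c _ ↦ (htest c).integrable_gradDeriv hφ hf, ← Finset.sum_neg_distrib]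
  exact Finset.sum_congr rfl fun c _ ↦ (htest c).integral_mul_driftLaplacian hφ hf

end LipschitzTest

/-! ### Cutoff functions and rigidity -/

section Cutoff

/-- The cutoff function of radius `R` around `x₀`, which falls linearly in the distance to `x₀`
from `1` at distance `R` to `0` at distance `2 R`. -/
def cutoff {M : Type*} [PseudoMetricSpace M] (x₀ : M) (R : ℝ) (x : M) : ℝ :=
  max 0 (min 1 (2 - R⁻¹ * dist x x₀))

variable {M : Type*} [PseudoMetricSpace M] {x₀ x : M} {R : ℝ}

lemma cutoff_nonneg (x₀ : M) (R : ℝ) (x : M) : 0 ≤ cutoff x₀ R x := le_max_left _ _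

lemma lipschitzWith_cutoff (x₀ : M) (R : ℝ) : LipschitzWith ‖R⁻¹‖₊ (cutoff x₀ R) := by
  have h : LipschitzWith ‖R⁻¹‖₊ fun x ↦ 2 - R⁻¹ * dist x x₀ := by
    refine LipschitzWith.of_dist_le_mul fun x z ↦ ?_
    rw [coe_nnnorm, dist_sub_left, dist_eq_norm, ← mul_sub, norm_mul]
    gcongr
    exact abs_dist_sub_le x z x₀
  exact (h.const_min 1).const_max 0

lemma cutoff_eq_one (hR : 0 < R) (hx : dist x x₀ ≤ R) : cutoff x₀ R x = 1 := by
  have : R⁻¹ * dist x x₀ ≤ 1 := by rwa [inv_mul_le_iff₀ hR, mul_one]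
  rw [cutoff, min_eq_left (by linarith), max_eq_right zero_le_one]

lemma cutoff_eq_zero (hR : 0 < R) (hx : 2 * R ≤ dist x x₀) : cutoff x₀ R x = 0 := by
  have : 2 ≤ R⁻¹ * dist x x₀ := by rwa [le_inv_mul_iff₀ hR, mul_comm]
  rw [cutoff, max_eq_left]
  exact (min_le_right _ _).trans (by linarith)

lemma hasCompactSupport_cutoff [ProperSpace M] (hR : 0 < R) (x₀ : M) :
    HasCompactSupport (cutoff x₀ R) := by
  refine .of_support_subset_isCompact (isCompact_closedBall x₀ (2 * R)) fun x hx ↦ ?_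
  by_contra hx'
  exact hx (cutoff_eq_zero hR (not_le.1 hx').le)

lemma tendsto_setLIntegral_compl_ball_atTop [MeasurableSpace M] [OpensMeasurableSpace M]
    {μ : Measure M} {h : M → ℝ≥0∞} {r : ℝ} (hint : ∫⁻ x in (Metric.ball x₀ r)ᶜ, h x ∂μ < ⊤) :
    Filter.Tendsto (fun R ↦ ∫⁻ x in (Metric.ball x₀ R)ᶜ, h x ∂μ) Filter.atTop (nhds 0) := by
  have hdensity : ∀ R : ℝ, ∫⁻ x in (Metric.ball x₀ R)ᶜ, h x ∂μ
      = (μ.withDensity h) (Metric.ball x₀ R)ᶜ := fun R ↦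
    (withDensity_apply _ measurableSet_ball.compl).symm
  have hempty : (⋂ R : ℝ, (Metric.ball x₀ R)ᶜ) = ∅ := by
    rw [← Set.compl_iUnion, Set.compl_empty_iff]
    exact Set.eq_univ_of_forall fun x ↦ Set.mem_iUnion.2 ⟨_, lt_add_one (dist x x₀)⟩
  simp only [hdensity] at hint ⊢
  rw [← measure_empty (μ := μ.withDensity h), ← hempty]
  exact tendsto_measure_iInter_atTop (fun R ↦ measurableSet_ball.compl.nullMeasurableSet)
    (fun R S hRS ↦ Set.compl_subset_compl.2 (Metric.ball_subset_ball hRS)) ⟨r, hint.ne⟩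

end Cutoff

section Rigidity

variable {n : ℕ} {M : Type*} [MetricSpace M] [ChartedSpace (EuclideanSpace ℝ (Fin n)) M]
  [IsManifold (𝓡 n) ∞ M] [RiemannianBundle (fun x : M ↦ TangentSpace (𝓡 n) x)]
  [IsContMDiffRiemannianBundle (𝓡 n) ∞ (EuclideanSpace ℝ (Fin n))
      (fun x : M ↦ TangentSpace (𝓡 n) x)] [IsRiemannianManifold (𝓡 n) M]
  {φ f : M → ℝ} {x₀ : M} {R r : ℝ}

lemma abs_gradDeriv_cutoff_le (hR : 0 < R) (f : M → ℝ) (x₀ x : M) :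
    |gradDeriv n f (cutoff x₀ R) x| ≤ (Metric.ball x₀ R)ᶜ.indicator
      (fun x ↦ 2 * ((dist x x₀)⁻¹ * ‖riemannianGradient n f x‖)) x := by
  by_cases hball : x ∈ Metric.ball x₀ R
  · have hone : cutoff x₀ R =ᶠ[nhds x] fun _ ↦ 1 := by
      filter_upwards [Metric.isOpen_ball.mem_nhds hball] with z hz
      exact cutoff_eq_one hR (Metric.mem_ball.1 hz).le
    rw [gradDeriv_eq_zero_of_eventuallyEq_const hone, abs_zero,
      Set.indicator_of_notMem (Set.notMem_compl_iff.2 hball)]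
  rw [Set.indicator_of_mem (Set.mem_compl hball)]
  have hRx : R ≤ dist x x₀ := not_lt.1 hball
  rcases lt_or_ge (2 * R) (dist x x₀) with hfar | hnear
  · have hzero : cutoff x₀ R =ᶠ[nhds x] fun _ ↦ 0 := by
      filter_upwards [(isOpen_lt continuous_const (continuous_id.dist continuous_const)).mem_nhds
        hfar] with z hz using cutoff_eq_zero hR (le_of_lt hz)
    rw [gradDeriv_eq_zero_of_eventuallyEq_const hzero, abs_zero]
    positivity
  · have hd : R⁻¹ ≤ 2 * (dist x x₀)⁻¹ := by
      rw [← div_eq_mul_inv, inv_eq_one_div, div_le_div_iff₀ hR (hR.trans_le hRx), one_mul]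
      exact hnear
    have hgrad := abs_mvfderiv_le_of_lipschitzWith (n := n) (lipschitzWith_cutoff x₀ R) x
      (riemannianGradient n f x)
    rw [coe_nnnorm, Real.norm_of_nonneg (inv_nonneg.2 hR.le)] at hgrad
    rw [← mul_assoc]
    exact hgrad.trans (by gcongr)

lemma enorm_gradDeriv_cutoff_le (hR : 0 < R) (f : M → ℝ) (x₀ x : M) :
    ‖gradDeriv n f (cutoff x₀ R) x‖ₑ ≤ (Metric.ball x₀ R)ᶜ.indicator
      (fun x ↦ 2 * ENNReal.ofReal ((dist x x₀)⁻¹ * ‖riemannianGradient n f x‖)) x := by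
  have h := ENNReal.ofReal_le_ofReal (abs_gradDeriv_cutoff_le (n := n) hR f x₀ x)
  rw [Real.enorm_eq_ofReal_abs]
  by_cases hx : x ∈ (Metric.ball x₀ R)ᶜ
  · rw [Set.indicator_of_mem hx, ENNReal.ofReal_mul zero_le_two, ENNReal.ofReal_ofNat] at h
    rwa [Set.indicator_of_mem hx]
  · rw [Set.indicator_of_notMem hx, ENNReal.ofReal_zero] at h
    rwa [Set.indicator_of_notMem hx]

variable [CompleteSpace M] [MeasurableSpace M] [BorelSpace M]

lemma setLIntegral_driftLaplacian_ball_le (hφ : ContMDiff (𝓡 n) 𝓘(ℝ, ℝ) ∞ φ)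
    (hf : ContMDiff (𝓡 n) 𝓘(ℝ, ℝ) ∞ f) (hsub : ∀ x, 0 ≤ driftLaplacian n φ f x) (x₀ : M)
    (hR : 0 < R) :
    ∫⁻ x in Metric.ball x₀ R, ENNReal.ofReal (driftLaplacian n φ f x) ∂(driftVolume n φ)
      ≤ 2 * ∫⁻ x in (Metric.ball x₀ R)ᶜ,
          ENNReal.ofReal ((dist x x₀)⁻¹ * ‖riemannianGradient n f x‖) ∂(driftVolume n φ) := by
  have : ProperSpace M := properSpace_of_isRiemannianManifold n M
  have hlip := lipschitzWith_cutoff x₀ R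
  have hc := hasCompactSupport_cutoff hR x₀
  calc ∫⁻ x in Metric.ball x₀ R, ENNReal.ofReal (driftLaplacian n φ f x) ∂(driftVolume n φ)
      = ∫⁻ x in Metric.ball x₀ R,
          ENNReal.ofReal (cutoff x₀ R x * driftLaplacian n φ f x) ∂(driftVolume n φ) :=
        setLIntegral_congr_fun measurableSet_ball fun x hx ↦ by
          simp only [cutoff_eq_one hR (Metric.mem_ball.1 hx).le, one_mul]
    _ ≤ ∫⁻ x, ENNReal.ofReal (cutoff x₀ R x * driftLaplacian n φ f x) ∂(driftVolume n φ) :=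
        setLIntegral_le_lintegral _ _
    _ = ENNReal.ofReal (∫ x, cutoff x₀ R x * driftLaplacian n φ f x ∂(driftVolume n φ)) :=
        (ofReal_integral_eq_lintegral_ofReal
          (integrable_mul_driftLaplacian hlip.continuous hc hφ hf)
          (.of_forall fun x ↦ mul_nonneg (cutoff_nonneg x₀ R x) (hsub x))).symm
    _ ≤ ‖∫ x, gradDeriv n f (cutoff x₀ R) x ∂(driftVolume n φ)‖ₑ := by
        rw [integral_mul_driftLaplacian hlip hc hφ hf, ← ofReal_norm]
        exact ENNReal.ofReal_le_ofReal (neg_le_abs _)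
    _ ≤ ∫⁻ x, ‖gradDeriv n f (cutoff x₀ R) x‖ₑ ∂(driftVolume n φ) :=
        enorm_integral_le_lintegral_enorm _
    _ ≤ ∫⁻ x, (Metric.ball x₀ R)ᶜ.indicator (fun x ↦
          2 * ENNReal.ofReal ((dist x x₀)⁻¹ * ‖riemannianGradient n f x‖)) x
            ∂(driftVolume n φ) :=
        lintegral_mono fun x ↦ enorm_gradDeriv_cutoff_le hR f x₀ x
    _ = 2 * ∫⁻ x in (Metric.ball x₀ R)ᶜ,
          ENNReal.ofReal ((dist x x₀)⁻¹ * ‖riemannianGradient n f x‖) ∂(driftVolume n φ) := by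
        rw [lintegral_indicator measurableSet_ball.compl,
          lintegral_const_mul' _ _ ENNReal.ofNat_ne_top]

theorem driftLaplacian_eq_zero (hφ : ContMDiff (𝓡 n) 𝓘(ℝ, ℝ) ∞ φ)
    (hf : ContMDiff (𝓡 n) 𝓘(ℝ, ℝ) ∞ f) (hsub : ∀ x, 0 ≤ driftLaplacian n φ f x)
    (hint : ∫⁻ x in (Metric.ball x₀ r)ᶜ,
        ENNReal.ofReal ((dist x x₀)⁻¹ * ‖riemannianGradient n f x‖) ∂(driftVolume n φ) < ⊤) :
    driftLaplacian n φ f = 0 := by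
  have : ProperSpace M := properSpace_of_isRiemannianManifold n M
  have := isOpenPosMeasure_driftVolume (n := n) hφ.continuous.measurable
  have hcont := continuous_driftLaplacian hφ hf
  have htail := ENNReal.Tendsto.const_mul (tendsto_setLIntegral_compl_ball_atTop hint)
    (.inr (ENNReal.ofNat_ne_top (n := 2)))
  rw [mul_zero] at htail
  have hball : ∀ R, ∫⁻ x in Metric.ball x₀ R,
      ENNReal.ofReal (driftLaplacian n φ f x) ∂(driftVolume n φ) = 0 := fun R ↦ by
    refine le_antisymm (ge_of_tendsto htail ?_) bot_le
    filter_upwards [Filter.eventually_ge_atTop R, Filter.eventually_gt_atTop 0] with S hRS hS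
    exact (lintegral_mono_set (Metric.ball_subset_ball hRS)).trans
      (setLIntegral_driftLaplacian_ball_le hφ hf hsub x₀ hS)
  have hae : ∀ k : ℕ, driftLaplacian n φ f =ᵐ[(driftVolume n φ).restrict (Metric.ball x₀ k)] 0 := by
    intro k
    filter_upwards [(lintegral_eq_zero_iff hcont.measurable.ennreal_ofReal).1 (hball k)] with x hx
    exact le_antisymm (ENNReal.ofReal_eq_zero.1 hx) (hsub x)
  have hunion := (ae_restrict_iUnion_iff _ _).2 hae
  rw [Metric.iUnion_ball_nat, Measure.restrict_univ] at hunion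
  exact (hcont.ae_eq_iff_eq _ continuous_zero).1 hunion

end Rigidity

section Soliton

variable {n : ℕ} {M : Type*} [TopologicalSpace M] [ChartedSpace (EuclideanSpace ℝ (Fin n)) M]
  [RiemannianBundle (fun x : M ↦ TangentSpace (𝓡 n) x)]

lemma weightedVolume_eq_driftVolume [MeasurableSpace M] (m : ℝ) (f : M → ℝ) :
    weightedVolume n m f = driftVolume n fun x ↦ 1 / m * f x := by
  simp only [weightedVolume, driftVolume, neg_div, one_div_mul_eq_div]

lemma driftLaplacian_const_mul_self {f : M → ℝ} (hf : ContMDiff (𝓡 n) 𝓘(ℝ, ℝ) ∞ f) (τ : ℝ)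
    (x : M) : driftLaplacian n (fun z ↦ τ * f z) f x
      = laplacian n f x - τ * ‖riemannianGradient n f x‖ ^ 2 := by
  rw [driftLaplacian, gradDeriv_const_mul (hf.mdifferentiable (by simp) x), gradDeriv_self]

variable [IsManifold (𝓡 n) ∞ M]

lemma trace_inv_metricAt_mul_dfAt (f : M → ℝ) (x : M) :
    ((metricAt n x)⁻¹ * dfAt n f x).trace = ‖riemannianGradient n f x‖ ^ 2 := by
  have h := gradDeriv_chart (mem_extChartAt_target (I := 𝓡 n) x) f f
  rw [extChartAt_to_inv] at h
  rw [← gradDeriv_self, h]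
  simp only [Matrix.trace, Matrix.diag, Matrix.mul_apply, metricAt, dfAt, dfMatrix,
    Matrix.of_apply, mul_assoc]

lemma laplacian_sub_eq_of_hessianAt_sub_eq {f : M → ℝ} {x : M} {τ a : ℝ}
    (h : hessianAt n f x - τ • dfAt n f x = a • metricAt n x) :
    laplacian n f x - τ * ‖riemannianGradient n f x‖ ^ 2 = n * a := by
  have hinv : (metricAt n x)⁻¹ * metricAt n x = 1 := Matrix.nonsing_inv_mul _
    (det_metricMatrix_pos (mem_extChartAt_target (I := 𝓡 n) x)).ne'.isUnit
  calc laplacian n f x - τ * ‖riemannianGradient n f x‖ ^ 2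
      = ((metricAt n x)⁻¹ * (hessianAt n f x - τ • dfAt n f x)).trace := by
        rw [laplacian, ← trace_inv_metricAt_mul_dfAt, Matrix.mul_sub, Matrix.mul_smul,
          Matrix.trace_sub, Matrix.trace_smul, smul_eq_mul]
    _ = n * a := by
        rw [h, Matrix.mul_smul, hinv, Matrix.trace_smul, Matrix.trace_one, Fintype.card_fin,
          smul_eq_mul, mul_comm]

end Soliton

end QuasiYamabe

end

/-- With `τ = 0` this covers the gradient `k`-Yamabe solitons `∇²f = (σₖ - λ) g`. -/
theorem theorem1p4_general {n : ℕ} (hn : 0 < n) {M : Type*} [MetricSpace M]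
    [ChartedSpace (EuclideanSpace ℝ (Fin n)) M] [IsManifold (𝓡 n) ∞ M]
    [Bundle.RiemannianBundle (fun x : M ↦ TangentSpace (𝓡 n) x)]
    [IsContMDiffRiemannianBundle (𝓡 n) ∞ (EuclideanSpace ℝ (Fin n))
      (fun x : M ↦ TangentSpace (𝓡 n) x)]
    [IsRiemannianManifold (𝓡 n) M] [CompleteSpace M] [MeasurableSpace M] [BorelSpace M]
    {τ : ℝ} {f h : M → ℝ} (hf : ContMDiff (𝓡 n) 𝓘(ℝ, ℝ) ∞ f)
    (hhess : ∀ x : M, QuasiYamabe.hessianAt n f x - τ • QuasiYamabe.dfAt n f x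
      = h x • QuasiYamabe.metricAt n x)
    {x₀ : M} {r : ℝ}
    (hint : ∫⁻ x in (Metric.ball x₀ r)ᶜ,
        ENNReal.ofReal ((dist x x₀)⁻¹ * ‖QuasiYamabe.riemannianGradient n f x‖)
          ∂(QuasiYamabe.driftVolume n fun x ↦ τ * f x) < ⊤)
    (hsub : ∀ x : M,
      0 ≤ QuasiYamabe.laplacian n f x - τ * ‖QuasiYamabe.riemannianGradient n f x‖ ^ 2) (x : M) :
    h x = 0 := by
  simp only [← QuasiYamabe.driftLaplacian_const_mul_self hf] at hsub
  have hzero := congrFun (QuasiYamabe.driftLaplacian_eq_zero (φ := fun z ↦ τ * f z)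
    (contMDiff_const.mul hf) hf hsub hint) x
  rw [QuasiYamabe.driftLaplacian_const_mul_self hf,
    QuasiYamabe.laplacian_sub_eq_of_hessianAt_sub_eq (hhess x)] at hzero
  exact (mul_eq_zero.1 hzero).resolve_left (Nat.cast_ne_zero.2 hn.ne')

theorem theorem1p4 {n k : ℕ} (hn : 3 ≤ n) (hk : 1 ≤ k) (hkn : k ≤ n)
    {M : Type*} [MetricSpace M] [ConnectedSpace M] [SecondCountableTopology M]
    [ChartedSpace (EuclideanSpace ℝ (Fin n)) M] [IsManifold (𝓡 n) ∞ M]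
    [Bundle.RiemannianBundle (fun x : M ↦ TangentSpace (𝓡 n) x)]
    [IsContMDiffRiemannianBundle (𝓡 n) ∞ (EuclideanSpace ℝ (Fin n))
      (fun x : M ↦ TangentSpace (𝓡 n) x)]
    [IsRiemannianManifold (𝓡 n) M]
    [CompleteSpace M] [NoncompactSpace M] [MeasurableSpace M] [BorelSpace M]
    (m lam : ℝ) (f : M → ℝ)
    (hsoliton : QuasiYamabe.IsQuasiYamabeGradientSoliton n M k m lam f)
    (x₀ : M) (r : ℝ) (hr : 0 < r)
    (hint : ∫⁻ x in (Metric.ball x₀ r)ᶜ,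
        ENNReal.ofReal ((dist x x₀)⁻¹ * ‖QuasiYamabe.riemannianGradient n f x‖)
          ∂(QuasiYamabe.weightedVolume n m f) < ⊤)
    (hsub : ∀ x : M,
      0 ≤ QuasiYamabe.laplacian n f x
        - (1 / m) * ‖QuasiYamabe.riemannianGradient n f x‖ ^ 2) :
    ∀ x : M, QuasiYamabe.sigmaCurvature n k x = lam := by
  rw [QuasiYamabe.weightedVolume_eq_driftVolume] at hint
  exact fun x ↦ sub_eq_zero.1 (theorem1p4_general (by omega) hsoliton.smooth
    hsoliton.equation hint hsub x)
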